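/- For a finite-dimensional nilpotent associative algebra $J$ over a finite field $\mathbb F_q$, let $1+J$ be the group of formal elements $1+x$ ($x\in J$) with product $(1+x)(1+y)=1+x+y+xy$ (an $\mathbb F_q$-algebra group). It acts on $J$ by conjugation and hence on $\mathrm{Irr}(J,+)$, the set of complex irreducible characters of the additive group of $J$. Say that $1+J$ *satisfies the Fake Degree Conjecture* if there is a bijection $e$ from the set of $(1+J)$-orbits $\Omega$ in $\mathrm{Irr}(J,+)$ onto $\mathrm{Irr}(1+J)$ with $e(\Omega)(1)=|\Omega|^{1/2}$ for every $\Omega$; that is, the irreducible character degrees of $1+J$ are, counting multiplicities, the square roots of the orbit sizes. The Fake Degree Conjecture for $\mathbb F_q$-algebra groups asserts that all $\mathbb F_q$-algebra groups satisfy this. **Theorem.** Let $p$ be any prime. The Fake Degree Conjecture for $\mathbb F_p$-algebra groups is false. More precisely, let $$\pi=\langle x_1,x_2,x_3,x_4 : x_i^p=[[x_j,x_k],x_l]=1 \text{ for all } i,j,k,l\rangle,\qquad z=[x_1,x_2][x_3,x_4]\in Z(\pi),\qquad \widetilde\pi=\pi/\langle z\rangle,$$ and let $I$ and $\widetilde I$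 be the augmentation ideals of $\mathbb F_p[\pi]$ and $\mathbb F_p[\widetilde\pi]$. Both ideals are finite and nilpotent, so that $1+I$ and $1+\widetilde I$ are $\mathbb F_p$-algebra groups, and at least one of these two groups does not satisfy the Fake Degree Conjecture. Writing $k(\cdot)$ for the number of conjugacy classes and $(\cdot)_{\mathrm{ab}}$ for the abelianization: 1. if $1+I$ satisfies the Fake Degree Conjecture, then $|(1+I)_{\mathrm{ab}}|=p^{k(\pi)-1}$; and if $1+\widetilde I$ satisfies it, then $|(1+\widetilde I)_{\mathrm{ab}}|=p^{k(\widetilde\pi)-1}$; 2. $|(1+I)_{\mathrm{ab}}|\cdot p^{k(\widetilde\pi)+1}\le |(1+\widetilde I)_{\mathrm{ab}}|\cdot p^{k(\pi)}$. In particular, if $1+\widetilde I$ satisfies the Fake Degree Conjecture, then $|(1+I)_{\mathrm{ab}}|\le p^{k(\pi)-2}$. -/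

import Mathlib

noncomputable section

namespace FakeDegree

open scoped commutatorElement

/-- A (non-unital, associative) ring `J` is nilpotent if all products of sufficiently many
elements vanish: `J ^ (n + 1) = 0` for some `n`. -/
def IsNilpotentAlgebra (J : Type*) [NonUnitalRing J] : Prop :=
  ∃ n : ℕ, ∀ (x : J) (l : List J), l.length = n → l.foldl (· * ·) x = 0

section AlgebraGroup

variable (F J : Type*) [Field F] [NonUnitalRing J] [Module F J] [IsScalarTower F J J]
  [SMulCommClass F J J]

/-- The `F`-algebra group `1 + J`: the group of units of `F·1 + J` with scalar part `1`.
For nilpotent `J` every `1 + j` is such a unit. -/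
abbrev AlgebraGroup : Type _ := Unitization.unitsFstOne F J

variable {F J}

/-- The conjugation action of `1 + J` on `J`: `g` acts by `a ↦ g a g⁻¹`. -/
def conj (g : AlgebraGroup F J) : J →+ J where
  toFun a := ((g : (Unitization F J)ˣ).val * (a : Unitization F J) *
    ((g⁻¹ : AlgebraGroup F J) : (Unitization F J)ˣ).val).snd
  map_zero' := by simp
  map_add' a b := by rw [Unitization.inr_add, mul_add, add_mul, Unitization.snd_add]

theorem inr_conj (g : AlgebraGroup F J) (a : J) :
    ((conj g a : J) : Unitization F J) = (g : (Unitization F J)ˣ).val * (a : Unitization F J) *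
      ((g⁻¹ : AlgebraGroup F J) : (Unitization F J)ˣ).val := by
  ext
  · simp
  · simp [conj]

theorem conj_one (a : J) : conj (1 : AlgebraGroup F J) a = a := by
  apply Unitization.inr_injective (R := F)
  rw [inr_conj]
  simp

theorem conj_mul (g h : AlgebraGroup F J) (a : J) : conj (g * h) a = conj g (conj h a) := by
  apply Unitization.inr_injective (R := F)
  rw [inr_conj, inr_conj, inr_conj]
  simp [mul_assoc]

/-- The coadjoint action of `1 + J` on the complex characters of the additive group of `J`,
`(g • φ) a = φ (g⁻¹ a g)`. -/
instance coadjointAction : MulAction (AlgebraGroup F J) (AddChar J ℂ) where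
  smul g φ := φ.compAddMonoidHom (conj g⁻¹)
  one_smul φ := by
    ext a
    change φ (conj (1 : AlgebraGroup F J)⁻¹ a) = φ a
    rw [inv_one, conj_one]
  mul_smul g h φ := by
    ext a
    change φ (conj (g * h)⁻¹ a) = φ (conj h⁻¹ (conj g⁻¹ a))
    rw [mul_inv_rev, conj_mul]

theorem coadjoint_apply (g : AlgebraGroup F J) (φ : AddChar J ℂ) (a : J) :
    (g • φ) a = φ (conj g⁻¹ a) := rfl

variable (F J)

/-- The set of `(1 + J)`-orbits in `Irr(J, +)`. -/
def CoadjointOrbit : Type _ :=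
  {Ω : Set (AddChar J ℂ) // ∃ φ : AddChar J ℂ, Ω = MulAction.orbit (AlgebraGroup F J) φ}

end AlgebraGroup

/-- The irreducible complex characters of a finite group `G`. -/
def IrrChar (G : Type*) [Group G] : Type _ :=
  {χ : G → ℂ // ∃ (n : ℕ) (ρ : Representation ℂ G (Fin n → ℂ)),
    ρ.IsIrreducible ∧ χ = ρ.character}

/-- The irreducible character degrees of `1 + J` coincide, counting multiplicities, with the
square roots of the cardinalities of the `(1 + J)`-orbits in `Irr(J, +)`. -/
def HasFakeDegrees (F J : Type*) [Field F] [NonUnitalRing J] [Module F J] [IsScalarTower F J J]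
    [SMulCommClass F J J] : Prop :=
  ∃ e : CoadjointOrbit F J ≃ IrrChar (AlgebraGroup F J),
    ∀ Ω : CoadjointOrbit F J, (e Ω).1 1 = ((Real.sqrt (Nat.card Ω.1) : ℝ) : ℂ)

/-- The Fake Degree Conjecture for `F`-algebra groups. -/
def FakeDegreeConjecture (F : Type) [Field F] : Prop :=
  ∀ (J : Type) [NonUnitalRing J] [Module F J] [IsScalarTower F J J] [SMulCommClass F J J]
    [Finite J], IsNilpotentAlgebra J → HasFakeDegrees F J

/-- The augmentation ideal of the group algebra `F[G]`, as a non-unital `F`-algebra. -/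
def augmentationIdeal (F G : Type*) [Field F] [Group G] :
    NonUnitalSubalgebra F (MonoidAlgebra F G) where
  carrier := {x | MonoidAlgebra.lift F F G 1 x = 0}
  zero_mem' := map_zero _
  add_mem' {x y} hx hy := by
    simp only [Set.mem_ofPred_eq] at hx hy ⊢
    rw [map_add, hx, hy, add_zero]
  mul_mem' {x y} hx hy := by
    simp only [Set.mem_ofPred_eq] at hx hy ⊢
    rw [map_mul, hx, zero_mul]
  smul_mem' c x hx := by
    simp only [Set.mem_ofPred_eq] at hx ⊢
    rw [map_smul, hx, smul_zero]

/-- The group `1 + I` of normalized units of the group algebra `F[G]`. -/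
abbrev NormalizedUnits (F G : Type*) [Field F] [Group G] : Type _ :=
  AlgebraGroup F (augmentationIdeal F G)

/-- The number of conjugacy classes of `G`. -/
def classNumber (G : Type*) [Group G] : ℕ := Nat.card (ConjClasses G)

/-- The relators `x_i ^ p` and `[[x_j, x_k], x_l]`. -/
def relators (p : ℕ) : Set (FreeGroup (Fin 4)) :=
  {r | ∃ i : Fin 4, r = FreeGroup.of i ^ p} ∪
    {r | ∃ j k l : Fin 4, r = ⁅⁅FreeGroup.of j, FreeGroup.of k⁆, FreeGroup.of l⁆}

/-- The group `π = ⟨x₁, x₂, x₃, x₄ : x_i ^ p = [x_j, x_k, x_l] = 1⟩`. -/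
abbrev PiGroup (p : ℕ) : Type := PresentedGroup (relators p)

/-- The central element `z = [x₁, x₂][x₃, x₄]` of `π`. -/
def zElement (p : ℕ) : PiGroup p :=
  ⁅(PresentedGroup.of 0 : PiGroup p), (PresentedGroup.of 1 : PiGroup p)⁆ *
    ⁅(PresentedGroup.of 2 : PiGroup p), (PresentedGroup.of 3 : PiGroup p)⁆

/-- The quotient `π / ⟨z⟩`; as `z` is central, `⟨z⟩` is the normal closure of `z`. -/
abbrev PiTilde (p : ℕ) : Type := PiGroup p ⧸ Subgroup.normalClosure {zElement p}

end FakeDegree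

end

/-! The conjecture predicts the order of an abelianization, and the predictions for `π` and `π/⟨z⟩`
are incompatible.

Orbits of size one must match the characters of degree one. The latter number `|(1 + J)_ab|`; the
former are the characters `φ` of `J` with `φ (x * y) = φ (y * x)`. On `F_p[G]` such a `φ` is an
arbitrary choice of a character of `F_p` for each conjugacy class. Splitting off the central summand
`F_p · 1` removes one factor `p`, so for the augmentation ideal the count is `p ^ (k(G) - 1)`
(`card_abelianization_normalizedUnits`).

Write `Q = π/⟨z⟩`, `k = k(Q)`, and filter `(1 + I)_ab` by the images of the units congruent to 1
modulo `(z - 1) ^ i`. As `(z - 1) ^ p = 0`, the filtration stops at `i = p`. The quotient by layer 1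
is a quotient of `(1 + Ĩ)_ab`. For `1 ≤ i < p` the map `a ↦ 1 + (z - 1) ^ i a` is additive modulo
the next layer, ignores multiples of `z - 1` and is invariant under conjugation by `π`. Hence each
layer quotient has order at most `p ^ k`. For `i = 1` the element `a = 1` gives `z`, which lies in
the commutator subgroup and dies, so one factor `p` is gained. Altogether `|(1 + I)_ab| ≤ |(1 +
Ĩ)_ab| * p ^ ((p - 1) * k - 1)`.

On the other side, `z` is a product of commutators, but by the Plücker relation no nontrivial power
of it is a single commutator (`dvd_of_commutator_eq_zElement_pow`). So multiplication by `z` moves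
classes freely and `p * k ≤ k(π)`. This yields `card_abelianization_unitsOne_mul_le`; inserting both
predicted orders gives a contradiction, off by exactly the factor gained from `z`. -/

noncomputable section

namespace FakeDegree

open scoped commutatorElement

/-! ### Groups of class two generated by elements of order `p` -/

section ClassTwo

variable {G : Type*} [Group G] {S : Set G} {p : ℕ}

theorem normal_of_le_center {H : Subgroup G} (h : H ≤ Subgroup.center G) : H.Normal :=
  ⟨fun n hn g => by rwa [Subgroup.mem_center_iff.1 (h hn) g, mul_inv_cancel_right]⟩

theorem closure_commutators_le_center (hS : Subgroup.closure S = ⊤)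
    (hc : ∀ x ∈ S, ∀ y ∈ S, ∀ w ∈ S, Commute ⁅x, y⁆ w) :
    Subgroup.closure {c | ∃ x ∈ S, ∃ y ∈ S, c = ⁅x, y⁆} ≤ Subgroup.center G := by
  rw [Subgroup.closure_le]
  rintro _ ⟨x, hx, y, hy, rfl⟩
  rw [SetLike.mem_coe, Subgroup.mem_center_iff]
  intro g
  have hg : g ∈ Subgroup.closure S := hS ▸ Subgroup.mem_top g
  have hle : Subgroup.closure S ≤ Subgroup.centralizer {⁅x, y⁆} := by
    rw [Subgroup.closure_le]
    intro w hw
    rw [SetLike.mem_coe, Subgroup.mem_centralizer_singleton_iff]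
    exact (hc x hx y hy w hw).eq.symm
  exact Subgroup.mem_centralizer_singleton_iff.1 (hle hg)

theorem commute_of_closure_eq_top (hS : Subgroup.closure S = ⊤)
    (hc : ∀ x ∈ S, ∀ y ∈ S, Commute x y) (a b : G) : Commute a b := by
  have key : ∀ x ∈ S, ∀ b, Commute x b := fun x hx b => by
    have hle : Subgroup.closure S ≤ Subgroup.centralizer {x} := by
      rw [Subgroup.closure_le]
      intro w hw
      exact Subgroup.mem_centralizer_singleton_iff.2 (hc x hx w hw).eq.symm
    exact (Subgroup.mem_centralizer_singleton_iff.1 (hle (hS ▸ Subgroup.mem_top b))).symm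
  have hle : Subgroup.closure S ≤ Subgroup.centralizer {b} := by
    rw [Subgroup.closure_le]
    intro w hw
    exact Subgroup.mem_centralizer_singleton_iff.2 (key w hw b).eq
  exact Subgroup.mem_centralizer_singleton_iff.1 (hle (hS ▸ Subgroup.mem_top a))

theorem pow_eq_one_of_closure_eq_top (hS : Subgroup.closure S = ⊤)
    (hc : ∀ x ∈ S, ∀ y ∈ S, Commute x y) (hp : ∀ x ∈ S, x ^ p = 1) (a : G) : a ^ p = 1 := by
  have ha : a ∈ Subgroup.closure S := hS ▸ Subgroup.mem_top a
  induction ha using Subgroup.closure_induction with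
  | mem x hx => exact hp x hx
  | one => exact one_pow p
  | mul x y _ _ hx hy => rw [(commute_of_closure_eq_top hS hc x y).mul_pow, hx, hy, one_mul]
  | inv x _ hx => rw [inv_pow, hx, inv_one]

theorem finite_of_closure_eq_top (hS : Subgroup.closure S = ⊤) (hfin : S.Finite)
    (hc : ∀ x ∈ S, ∀ y ∈ S, Commute x y) (hp0 : 0 < p) (hp : ∀ x ∈ S, x ^ p = 1) :
    Finite G := by
  let _ : CommGroup G :=
    { ‹Group G› with mul_comm := fun a b => (commute_of_closure_eq_top hS hc a b).eq }
  have : Group.FG G := Group.fg_iff.2 ⟨S, hS, hfin⟩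
  refine CommGroup.finite_of_fg_isMulTorsion G ?_
  intro a
  exact isOfFinOrder_iff_pow_eq_one.2 ⟨p, hp0, pow_eq_one_of_closure_eq_top hS hc hp a⟩

/-- A group generated by finitely many elements of order `p` whose commutators are central is a
finite `p`-group. -/
theorem finite_and_isPGroup (hS : Subgroup.closure S = ⊤) (hfin : S.Finite)
    (hc : ∀ x ∈ S, ∀ y ∈ S, ∀ w ∈ S, Commute ⁅x, y⁆ w) (hp0 : 0 < p) (hp : ∀ x ∈ S, x ^ p = 1) :
    Finite G ∧ IsPGroup p G := by
  set T : Set G := {c | ∃ x ∈ S, ∃ y ∈ S, c = ⁅x, y⁆} with hT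
  set C := Subgroup.closure T with hC
  have hCZ : C ≤ Subgroup.center G := closure_commutators_le_center hS hc
  have hTZ : ∀ c ∈ T, ∀ g, Commute g c := fun c hcT g =>
    Subgroup.mem_center_iff.1 (hCZ (Subgroup.subset_closure hcT)) g
  have : C.Normal := normal_of_le_center hCZ
  have hTp : ∀ c ∈ T, c ^ p = 1 := by
    rintro _ ⟨x, hx, y, hy, rfl⟩
    -- The conjugate of `y` also has `p`-th power 1; as `⁅x, y⁆` is central, this forces `⁅x, y⁆ ^ p
    -- = 1`.
    have hxy : x * y * x⁻¹ = ⁅x, y⁆ * y := by rw [commutatorElement_def]; group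
    have h1 : (x * y * x⁻¹) ^ p = 1 := by rw [conj_pow, hp y hy]; simp
    rw [hxy, (hTZ _ ⟨x, hx, y, hy, rfl⟩ y).symm.mul_pow, hp y hy, mul_one] at h1
    exact h1
  have hTfin : T.Finite := by
    refine (Set.Finite.image2 (fun x y => ⁅x, y⁆) hfin hfin).subset ?_
    rintro _ ⟨x, hx, y, hy, rfl⟩
    exact ⟨x, hx, y, hy, rfl⟩
  -- the subgroup generated by the commutators
  have hS₁ : Subgroup.closure ((C.subtype) ⁻¹' T) = ⊤ := Subgroup.closure_closure_coe_preimage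
  have hc₁ : ∀ x ∈ (C.subtype) ⁻¹' T, ∀ y ∈ (C.subtype) ⁻¹' T, Commute x y := fun x _ y hy =>
    Subtype.ext (hTZ _ hy x)
  have hp₁ : ∀ x ∈ (C.subtype) ⁻¹' T, x ^ p = 1 := fun x hx => Subtype.ext (hTp _ hx)
  have : Finite C := finite_of_closure_eq_top hS₁
    (hTfin.preimage Subtype.val_injective.injOn) hc₁ hp0 hp₁
  -- the quotient by it
  have hS₂ : Subgroup.closure ((QuotientGroup.mk' C) '' S) = ⊤ := by
    rw [← MonoidHom.map_closure, hS, ← MonoidHom.range_eq_map, QuotientGroup.range_mk']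
  have hc₂ : ∀ x ∈ (QuotientGroup.mk' C) '' S, ∀ y ∈ (QuotientGroup.mk' C) '' S,
      Commute x y := by
    rintro _ ⟨x, hx, rfl⟩ _ ⟨y, hy, rfl⟩
    rw [← commutatorElement_eq_one_iff_commute, ← map_commutatorElement]
    exact (QuotientGroup.eq_one_iff _).2 (Subgroup.subset_closure ⟨x, hx, y, hy, rfl⟩)
  have hp₂ : ∀ x ∈ (QuotientGroup.mk' C) '' S, x ^ p = 1 := by
    rintro _ ⟨x, hx, rfl⟩
    rw [← map_pow, hp x hx, map_one]
  have : Finite (G ⧸ C) := finite_of_closure_eq_top hS₂ (hfin.image _) hc₂ hp0 hp₂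
  refine ⟨Finite.of_subgroup_quotient C, ?_⟩
  rw [isPGroup_iff_pow_pow_eq_one]
  intro g
  -- Both `G ⧸ C` and `C` have exponent dividing `p`, so `g ^ (p ^ 2) = 1`.
  refine ⟨2, ?_⟩
  have hgC : g ^ p ∈ C := (QuotientGroup.eq_one_iff _).1
    (pow_eq_one_of_closure_eq_top hS₂ hc₂ hp₂ (g : G ⧸ C))
  have := pow_eq_one_of_closure_eq_top hS₁ hc₁ hp₁ ⟨g ^ p, hgC⟩
  rw [pow_two, pow_mul]
  exact congrArg Subtype.val this

end ClassTwo

/-! ### Elementary properties of `π` and `z` -/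

section Presentation

variable (p : ℕ)

theorem PiGroup.of_pow (i : Fin 4) : (PresentedGroup.of i : PiGroup p) ^ p = 1 :=
  PresentedGroup.one_of_mem (rels := relators p) (Or.inl ⟨i, rfl⟩)

theorem PiGroup.commute_commutator_of (i j l : Fin 4) :
    Commute ⁅(PresentedGroup.of i : PiGroup p), (PresentedGroup.of j : PiGroup p)⁆ (PresentedGroup.of l) := by
  rw [← commutatorElement_eq_one_iff_commute]
  exact PresentedGroup.one_of_mem (rels := relators p) (Or.inr ⟨i, j, l, rfl⟩)

theorem PiGroup.finite_and_isPGroup [hp : Fact p.Prime] :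
    Finite (PiGroup p) ∧ IsPGroup p (PiGroup p) := by
  refine FakeDegree.finite_and_isPGroup (S := Set.range PresentedGroup.of)
    (PresentedGroup.closure_range_of _) (Set.finite_range _) ?_ hp.out.pos ?_
  · rintro _ ⟨i, rfl⟩ _ ⟨j, rfl⟩ _ ⟨l, rfl⟩
    exact PiGroup.commute_commutator_of p i j l
  · rintro _ ⟨i, rfl⟩
    exact PiGroup.of_pow p i

instance [Fact p.Prime] : Finite (PiGroup p) := (PiGroup.finite_and_isPGroup p).1

theorem PiGroup.commute_commutator (i j : Fin 4) (g : PiGroup p) :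
    Commute g ⁅(PresentedGroup.of i : PiGroup p), (PresentedGroup.of j : PiGroup p)⁆ := by
  have h := closure_commutators_le_center (S := Set.range (PresentedGroup.of (rels := relators p)))
    (PresentedGroup.closure_range_of _) (by
      rintro _ ⟨i, rfl⟩ _ ⟨j, rfl⟩ _ ⟨l, rfl⟩
      exact PiGroup.commute_commutator_of p i j l)
  exact Subgroup.mem_center_iff.1 (h (Subgroup.subset_closure ⟨_, ⟨i, rfl⟩, _, ⟨j, rfl⟩, rfl⟩)) g

theorem zElement_mem_center : zElement p ∈ Subgroup.center (PiGroup p) :=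
  Subgroup.mem_center_iff.2 fun g =>
    ((PiGroup.commute_commutator p 0 1 g).mul_right (PiGroup.commute_commutator p 2 3 g)).eq

theorem PiGroup.commutator_pow (i j : Fin 4) :
    ⁅(PresentedGroup.of i : PiGroup p), (PresentedGroup.of j : PiGroup p)⁆ ^ p = 1 := by
  set x : PiGroup p := PresentedGroup.of i
  set y : PiGroup p := PresentedGroup.of j
  have hxy : x * y * x⁻¹ = ⁅x, y⁆ * y := by rw [commutatorElement_def]; group
  have h1 : (x * y * x⁻¹) ^ p = 1 := by rw [conj_pow, PiGroup.of_pow p j]; simp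
  rw [hxy, (PiGroup.commute_commutator p i j y).symm.mul_pow, PiGroup.of_pow p j, mul_one] at h1
  exact h1

theorem zElement_pow : zElement p ^ p = 1 := by
  rw [zElement, (PiGroup.commute_commutator p 2 3 _).mul_pow, PiGroup.commutator_pow,
    PiGroup.commutator_pow, one_mul]

theorem zElement_mem_commutator : zElement p ∈ commutator (PiGroup p) :=
  mul_mem (Subgroup.commutator_mem_commutator (Subgroup.mem_top _) (Subgroup.mem_top _))
    (Subgroup.commutator_mem_commutator (Subgroup.mem_top _) (Subgroup.mem_top _))

end Presentation

/-! ### A concrete model detecting commutators -/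

/-- The class two group on `F⁴ × F^{4 × 4}` whose commutators are the `2 × 2` minors: the product
adds to the matrix parts the strictly upper triangular part of the tensor product. -/
@[ext]
structure MinorGroup (F : Type*) where
  vec : Fin 4 → F
  mat : Fin 4 → Fin 4 → F

namespace MinorGroup

variable {F : Type*} [CommRing F]

/-- The strictly upper triangular part of the tensor product of two vectors. -/
def upper (v w : Fin 4 → F) (i j : Fin 4) : F := if i < j then v i * w j else 0

instance : Mul (MinorGroup F) := ⟨fun a b => ⟨a.vec + b.vec, a.mat + b.mat + upper a.vec b.vec⟩⟩
instance : One (MinorGroup F) := ⟨⟨0, 0⟩⟩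
instance : Inv (MinorGroup F) := ⟨fun a => ⟨-a.vec, -a.mat + upper a.vec a.vec⟩⟩

theorem vec_mul (a b : MinorGroup F) : (a * b).vec = a.vec + b.vec := rfl
theorem mat_mul (a b : MinorGroup F) : (a * b).mat = a.mat + b.mat + upper a.vec b.vec := rfl
theorem vec_one : (1 : MinorGroup F).vec = 0 := rfl
theorem mat_one : (1 : MinorGroup F).mat = 0 := rfl
theorem vec_inv (a : MinorGroup F) : (a⁻¹).vec = -a.vec := rfl
theorem mat_inv (a : MinorGroup F) : (a⁻¹).mat = -a.mat + upper a.vec a.vec := rfl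

instance : Group (MinorGroup F) :=
  Group.ofLeftAxioms
    (fun a b c => by
      ext i j
      · simp [vec_mul, add_assoc]
      · simp only [vec_mul, mat_mul, upper, Pi.add_apply]
        split_ifs <;> ring)
    (fun a => by
      ext i j
      · simp [vec_mul, vec_one]
      · simp [vec_one, mat_mul, mat_one, upper])
    (fun a => by
      ext i j
      · simp [vec_mul, vec_inv, vec_one]
      · simp only [vec_inv, mat_mul, mat_inv, mat_one, upper, Pi.add_apply, Pi.neg_apply,
          Pi.zero_apply]
        split_ifs <;> ring)

theorem vec_commutator (a b : MinorGroup F) : ⁅a, b⁆.vec = 0 := by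
  simp [commutatorElement_def, vec_mul, vec_inv]

/-- Above the diagonal the entries are `v i * w j - w i * v j`, the Plücker coordinates of the pair
of vectors. -/
theorem mat_commutator (a b : MinorGroup F) :
    ⁅a, b⁆.mat = upper a.vec b.vec - upper b.vec a.vec := by
  ext i j
  simp only [commutatorElement_def, vec_mul, mat_mul, vec_inv, mat_inv, upper, Pi.add_apply,
    Pi.neg_apply, Pi.sub_apply]
  split_ifs <;> ring

theorem commutator_commutator (a b c : MinorGroup F) : ⁅⁅a, b⁆, c⁆ = 1 := by
  ext i j
  · rw [vec_commutator, vec_one]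
  · rw [mat_commutator, vec_commutator, mat_one]
    simp [upper]

/-- The generators. -/
def gen (i : Fin 4) : MinorGroup F := ⟨Pi.single i 1, 0⟩

/-- Since only the strictly upper triangular part is kept, powers of a basis vector pick up no
matrix part. Thus the generators have order `p` even when `p = 2`. -/
theorem gen_pow (i : Fin 4) (n : ℕ) :
    (gen i : MinorGroup F) ^ n = ⟨Pi.single i (n : F), 0⟩ := by
  induction n with
  | zero => ext <;> simp [vec_one, mat_one]
  | succ n ih =>
    rw [pow_succ, ih]
    ext k l
    · simp [vec_mul, gen, Pi.single_add]
    · simp only [mat_mul, gen, upper, Pi.add_apply, Pi.zero_apply]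
      by_cases hk : k = i
      · by_cases hl : l = i
        · simp [hk, hl]
        · simp [hl]
      · simp [hk]

theorem pow_of_vec_eq_zero {a : MinorGroup F} (ha : a.vec = 0) (n : ℕ) :
    a ^ n = ⟨0, n • a.mat⟩ := by
  induction n with
  | zero => ext <;> simp [vec_one, mat_one]
  | succ n ih =>
    rw [pow_succ, ih]
    ext k l
    · simp [vec_mul, ha]
    · simp [mat_mul, ha, upper, add_mul]

end MinorGroup

/-! ### Powers of `z` that are commutators -/

section Presentation

variable (p : ℕ)

/-- The homomorphism from `π` to the group of `2 × 2` minors sending generators to generators. -/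
def toMinorGroup : PiGroup p →* MinorGroup (ZMod p) :=
  PresentedGroup.toGroup (f := MinorGroup.gen) (by
    rintro r (⟨i, rfl⟩ | ⟨j, k, l, rfl⟩)
    · rw [map_pow, FreeGroup.lift_apply_of, MinorGroup.gen_pow]
      ext <;> simp [MinorGroup.vec_one, MinorGroup.mat_one]
    · rw [map_commutatorElement, map_commutatorElement, MinorGroup.commutator_commutator])

theorem toMinorGroup_zElement :
    toMinorGroup p (zElement p) = ⁅(MinorGroup.gen 0 : MinorGroup (ZMod p)), (MinorGroup.gen 1 : MinorGroup (ZMod p))⁆ *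
      ⁅(MinorGroup.gen 2 : MinorGroup (ZMod p)), (MinorGroup.gen 3 : MinorGroup (ZMod p))⁆ := by
  simp [zElement, toMinorGroup, map_commutatorElement]

/-- By the Plücker relation no power of `z` other than `1` is a commutator. -/
theorem dvd_of_commutator_eq_zElement_pow [Fact p.Prime] {g h : PiGroup p} {n : ℕ}
    (hgh : ⁅g, h⁆ = zElement p ^ n) : p ∣ n := by
  have key := congrArg (fun x => (toMinorGroup p x).mat) hgh
  have hvec : (⁅(MinorGroup.gen 0 : MinorGroup (ZMod p)), (MinorGroup.gen 1 : MinorGroup (ZMod p))⁆ *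
      ⁅(MinorGroup.gen 2 : MinorGroup (ZMod p)), (MinorGroup.gen 3 : MinorGroup (ZMod p))⁆).vec = 0 := by
    rw [MinorGroup.vec_mul, MinorGroup.vec_commutator, MinorGroup.vec_commutator, add_zero]
  simp only [map_commutatorElement, map_pow, toMinorGroup_zElement,
    MinorGroup.pow_of_vec_eq_zero hvec, MinorGroup.mat_commutator, MinorGroup.mat_mul,
    MinorGroup.vec_commutator] at key
  set v := (toMinorGroup p g).vec
  set w := (toMinorGroup p h).vec
  have e (i j : Fin 4) := congrFun (congrFun key i) j
  have e01 := e 0 1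
  have e02 := e 0 2
  have e03 := e 0 3
  have e12 := e 1 2
  have e13 := e 1 3
  have e23 := e 2 3
  simp [MinorGroup.upper, MinorGroup.gen] at e01 e02 e03 e12 e13 e23
  rw [← CharP.cast_eq_zero_iff (ZMod p) p]
  -- With `m i j` the minors, `m 0 1 = m 2 3 = n` and the others vanish, so the Plücker relation `m
  -- 0 1 * m 2 3 - m 0 2 * m 1 3 + m 0 3 * m 1 2 = 0` reads `n ^ 2 = 0`.
  refine pow_eq_zero_iff (two_ne_zero) |>.1 ?_
  linear_combination (-(n : ZMod p)) * e01 - (v 0 * w 1 - w 0 * v 1) * e23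
    + (v 0 * w 2 - w 0 * v 2) * e13 - (v 0 * w 3 - w 0 * v 3) * e12

theorem normalClosure_zElement :
    Subgroup.normalClosure {zElement p} = Subgroup.zpowers (zElement p) := by
  have hz := zElement_mem_center p
  have : (Subgroup.zpowers (zElement p)).Normal :=
    normal_of_le_center (by rwa [Subgroup.zpowers_le])
  refine le_antisymm (Subgroup.normalClosure_le_normal ?_) ?_
  · simp
  · rw [Subgroup.zpowers_le]
    exact Subgroup.subset_normalClosure rfl

end Presentation

/-! ### Nilpotency of the augmentation ideal -/

section Augmentation

/-- The augmentation map of the group algebra. -/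
abbrev augmentation (F G : Type*) [Field F] [Group G] : MonoidAlgebra F G →ₐ[F] F :=
  MonoidAlgebra.lift F F G 1

theorem mem_augmentationIdeal {F G : Type*} [Field F] [Group G] {x : MonoidAlgebra F G} :
    x ∈ augmentationIdeal F G ↔ augmentation F G x = 0 := Iff.rfl

instance finite_monoidAlgebra (F G : Type*) [Field F] [Finite F] [Finite G] :
    Finite (MonoidAlgebra F G) :=
  Finite.of_injective (fun a : MonoidAlgebra F G => (a.coeff : G → F)) fun a b h => by
    ext g
    exact congrFun h g

variable {p : ℕ} [hp : Fact p.Prime] {G : Type*} [Group G] [Finite G]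

theorem smul_eq_augmentation_smul {F G : Type*} [Field F] [Group G] {M : Type*} [AddCommGroup M]
    [Module (MonoidAlgebra F G) M] {b : M} (hb : ∀ g : G, MonoidAlgebra.of F G g • b = b)
    (a : MonoidAlgebra F G) : a • b = algebraMap F (MonoidAlgebra F G) (augmentation F G a) • b := by
  induction a using MonoidAlgebra.induction_linear with
  | zero => simp
  | add x y hx hy => rw [add_smul, hx, hy, map_add, map_add, add_smul]
  | single g r =>
    have h : MonoidAlgebra.single g r = algebraMap F (MonoidAlgebra F G) r * MonoidAlgebra.of F G g := by simp
    rw [h, mul_smul, hb, ← h]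
    simp

/-- A `p`-group acting on a simple module over `F_p[G]` fixes a nonzero vector. That vector
generates the module, and the group algebra acts on it through the augmentation. -/
theorem mem_jacobson_of_augmentation_eq_zero (hG : IsPGroup p G) {a : MonoidAlgebra (ZMod p) G}
    (ha : augmentation (ZMod p) G a = 0) :
    a ∈ Ideal.jacobson (⊥ : Ideal (MonoidAlgebra (ZMod p) G)) := by
  rw [Ideal.jacobson, Submodule.mem_sInf]
  rintro m ⟨-, hm⟩
  have hsimple : IsSimpleModule (MonoidAlgebra (ZMod p) G) (MonoidAlgebra (ZMod p) G ⧸ m) :=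
    isSimpleModule_iff_isCoatom.2 hm.out
  set M := MonoidAlgebra (ZMod p) G ⧸ m
  have hfin : Finite M := Quotient.finite _
  have hnt : Nontrivial M := IsSimpleModule.nontrivial (MonoidAlgebra (ZMod p) G) M
  let _ : MulAction G M := MulAction.compHom M (MonoidAlgebra.of (ZMod p) G)
  have hpM : ∀ x : M, p • x = 0 := fun x => by
    rw [← Nat.cast_smul_eq_nsmul (MonoidAlgebra (ZMod p) G),
      ← map_natCast (algebraMap (ZMod p) (MonoidAlgebra (ZMod p) G)), CharP.cast_eq_zero,
      map_zero, zero_smul]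
  have hdvd : p ∣ Nat.card M := by
    obtain ⟨x, hx⟩ := exists_ne (0 : M)
    rw [← addOrderOf_eq_prime (hpM x) hx]
    exact addOrderOf_dvd_natCard x
  -- The number of fixed points is divisible by `p` and 0 is one of them, so there is another.
  obtain ⟨b, hb, hb0⟩ := hG.exists_fixed_point_of_prime_dvd_card_of_fixed_point M hdvd
    (a := (0 : M)) (fun g => smul_zero (MonoidAlgebra.of (ZMod p) G g))
  have hspan := IsSimpleModule.span_singleton_eq_top (MonoidAlgebra (ZMod p) G) (Ne.symm hb0)
  obtain ⟨r, hr⟩ := Submodule.mem_span_singleton.1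
    (hspan ▸ Submodule.mem_top : (Submodule.Quotient.mk 1 : M) ∈
      Submodule.span (MonoidAlgebra (ZMod p) G) {b})
  have h0 : a • (Submodule.Quotient.mk 1 : M) = 0 := by
    rw [← hr, ← mul_smul, smul_eq_augmentation_smul (fun g => hb g), map_mul, ha,
      zero_mul, map_zero, zero_smul]
  rw [← Submodule.Quotient.mk_smul, smul_eq_mul, mul_one] at h0
  exact (Submodule.Quotient.mk_eq_zero m).1 h0

/-- The augmentation ideal of a finite `p`-group over `ZMod p` is nilpotent. -/
theorem exists_prod_eq_zero (hG : IsPGroup p G) : ∃ n : ℕ, ∀ l : List (MonoidAlgebra (ZMod p) G),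
    l.length = n → (∀ a ∈ l, augmentation (ZMod p) G a = 0) → l.prod = 0 := by
  have : IsArtinianRing (MonoidAlgebra (ZMod p) G) := inferInstance
  obtain ⟨n, hn⟩ := IsArtinianRing.isNilpotent_jacobson_bot (R := MonoidAlgebra (ZMod p) G)
  refine ⟨n, fun l hl ha => ?_⟩
  have key : ∀ l : List (MonoidAlgebra (ZMod p) G),
      (∀ a ∈ l, augmentation (ZMod p) G a = 0) →
      l.prod ∈ Ideal.jacobson (⊥ : Ideal (MonoidAlgebra (ZMod p) G)) ^ l.length := by
    intro l
    induction l using List.reverseRecOn with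
    | nil =>
      intro _
      rw [List.length_nil, Submodule.pow_zero, Ideal.one_eq_top]
      exact Submodule.mem_top
    | append_singleton l a ih =>
      intro h
      rw [List.prod_append, List.prod_singleton, List.length_append, List.length_singleton,
        Submodule.pow_succ]
      exact Ideal.mul_mem_mul (ih fun b hb => h b (List.mem_append_left _ hb))
        (mem_jacobson_of_augmentation_eq_zero hG (h a (by simp)))
  have := key l ha
  rw [hl, hn] at this
  simpa using this

theorem isNilpotentAlgebra_augmentationIdeal (hG : IsPGroup p G) :
    IsNilpotentAlgebra (augmentationIdeal (ZMod p) G) := by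
  obtain ⟨n, hn⟩ := exists_prod_eq_zero hG
  refine ⟨n, fun x l hl => ?_⟩
  have key : ∀ (l : List (augmentationIdeal (ZMod p) G)) (x : augmentationIdeal (ZMod p) G),
      ((l.foldl (· * ·) x : augmentationIdeal (ZMod p) G) : MonoidAlgebra (ZMod p) G) =
        x * (l.map Subtype.val).prod := by
    intro l
    induction l with
    | nil => simp
    | cons a l ih =>
      intro x
      rw [List.foldl_cons, ih, List.map_cons, List.prod_cons, ← mul_assoc]
      rfl
  ext1
  rw [key, hn _ (by simpa using hl)]
  · simp
  · intro a ha
    obtain ⟨b, -, rfl⟩ := List.mem_map.1 ha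
    exact b.2

theorem isUnit_of_augmentation_eq_one (hG : IsPGroup p G) {a : MonoidAlgebra (ZMod p) G}
    (ha : augmentation (ZMod p) G a = 1) : IsUnit a := by
  obtain ⟨n, hn⟩ := exists_prod_eq_zero hG
  have hnil : IsNilpotent (a - 1) := by
    refine ⟨n, ?_⟩
    rw [← List.prod_replicate]
    refine hn _ (by simp) fun b hb => ?_
    rw [List.eq_of_mem_replicate hb, map_sub, ha, map_one, sub_self]
  simpa using hnil.isUnit_add_one

end Augmentation

/-! ### `1 + I` as the units of augmentation one -/

section Units

variable (F G : Type*) [Field F] [Group G]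

/-- The unitization of the augmentation ideal is the group algebra. -/
def unitizationHom : Unitization F (augmentationIdeal F G) →ₐ[F] MonoidAlgebra F G :=
  Unitization.lift (NonUnitalSubalgebraClass.subtype (augmentationIdeal F G))

variable {F G}

theorem unitizationHom_apply (x : Unitization F (augmentationIdeal F G)) :
    unitizationHom F G x = algebraMap F _ x.fst + x.snd := by
  simp [unitizationHom]

theorem augmentation_unitizationHom (x : Unitization F (augmentationIdeal F G)) :
    augmentation F G (unitizationHom F G x) = x.fst := by
  rw [unitizationHom_apply, map_add, AlgHom.commutes, mem_augmentationIdeal.1 x.snd.2, add_zero]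
  rfl

theorem unitizationHom_bijective : Function.Bijective (unitizationHom F G) := by
  constructor
  · intro x y h
    have h1 : x.fst = y.fst := by
      rw [← augmentation_unitizationHom, h, augmentation_unitizationHom]
    rw [unitizationHom_apply, unitizationHom_apply, h1] at h
    exact Unitization.ext h1 (Subtype.ext (add_left_cancel h))
  · intro a
    have ha : a - algebraMap F _ (augmentation F G a) ∈ augmentationIdeal F G := by
      rw [mem_augmentationIdeal, map_sub, AlgHom.commutes]
      simp
    refine ⟨Unitization.inl (augmentation F G a) + Unitization.inr ⟨_, ha⟩, ?_⟩
    rw [unitizationHom_apply]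
    simp

variable (F G)

/-- The unitization of the augmentation ideal is the group algebra. -/
def unitizationEquiv : Unitization F (augmentationIdeal F G) ≃ₐ[F] MonoidAlgebra F G :=
  AlgEquiv.ofBijective (unitizationHom F G) unitizationHom_bijective

/-- The units of augmentation one of the group algebra. -/
def unitsOne : Subgroup (MonoidAlgebra F G)ˣ :=
  (Units.map (augmentation F G : MonoidAlgebra F G →* F)).ker

variable {F G}

theorem mem_unitsOne {u : (MonoidAlgebra F G)ˣ} :
    u ∈ unitsOne F G ↔ augmentation F G u.val = 1 := by
  rw [unitsOne, MonoidHom.mem_ker, Units.ext_iff]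
  rfl

variable (F G)

/-- `1 + I` is the group of units of augmentation one. -/
def normalizedUnitsEquiv : NormalizedUnits F G ≃* unitsOne F G :=
  ((Units.mapEquiv (unitizationEquiv F G).toMulEquiv).subgroupMap _).trans
    (MulEquiv.subgroupCongr (by
      ext u
      rw [mem_unitsOne, Subgroup.mem_map]
      constructor
      · rintro ⟨v, hv, rfl⟩
        exact (augmentation_unitizationHom v.val).trans hv
      · intro hu
        refine ⟨(Units.mapEquiv (unitizationEquiv F G).toMulEquiv).symm u, ?_, ?_⟩
        · rw [Unitization.mem_unitsFstOne, ← hu, ← augmentation_unitizationHom]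
          congr 1
          exact (unitizationEquiv F G).apply_symm_apply u.val
        · exact (Units.mapEquiv (unitizationEquiv F G).toMulEquiv).apply_symm_apply u))

end Units

/-! ### Characters of degree one -/

section LinearCharacters

variable (G : Type*) [Group G]

/-- The one-dimensional representation attached to a linear character. -/
def linearRep {G : Type*} [Group G] (f : G →* ℂˣ) : Representation ℂ G (Fin 1 → ℂ) where
  toFun g := (f g : ℂ) • LinearMap.id
  map_one' := by simp [Module.End.one_eq_id]
  map_mul' g h := by
    ext
    simp only [map_mul, Units.val_mul, Module.End.mul_eq_comp, LinearMap.coe_comp,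
      Function.comp_apply, LinearMap.smul_apply, LinearMap.id_apply, map_smul, mul_smul]
    rw [smul_comm]

variable {G} in
theorem linearRep_isIrreducible (f : G →* ℂˣ) : (linearRep f).IsIrreducible := by
  have hsimple : IsSimpleModule ℂ (Fin 1 → ℂ) :=
    isSimpleModule_iff_finrank_eq_one.2 (by simp)
  have hs := (isSimpleModule_iff ℂ (Fin 1 → ℂ)).1 hsimple
  refine { exists_pair_ne := ⟨⊥, ⊤, fun h => ?_⟩, eq_bot_or_eq_top := fun W => ?_ }
  · exact bot_ne_top (congrArg Subrepresentation.toSubmodule h)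
  · exact (hs.eq_bot_or_eq_top W.toSubmodule).imp
      (fun h => Subrepresentation.toSubmodule_injective h)
      (fun h => Subrepresentation.toSubmodule_injective h)

variable {G} in
theorem linearRep_character (f : G →* ℂˣ) (g : G) : (linearRep f).character g = f g := by
  change LinearMap.trace ℂ (Fin 1 → ℂ) ((f g : ℂ) • LinearMap.id) = f g
  rw [map_smul, LinearMap.trace_id]
  simp

/-- The number of irreducible characters of degree one of a finite group is the order of its
abelianization. -/
theorem card_linear_irrChar [Finite G] :
    Nat.card {χ : IrrChar G // χ.1 1 = 1} = Nat.card (Abelianization G) := by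
  rw [← CommGroup.card_monoidHom_of_hasEnoughRootsOfUnity (Abelianization G) ℂ]
  refine Nat.card_congr (Equiv.trans (Equiv.ofBijective (fun f : G →* ℂˣ =>
    (⟨⟨_, 1, linearRep f, linearRep_isIrreducible f, rfl⟩, by simp⟩ :
      {χ : IrrChar G // χ.1 1 = 1})) ⟨?_, ?_⟩).symm Abelianization.lift)
  · intro f f' h
    ext g
    have := congrFun (congrArg (fun χ => χ.1.1) h) g
    simpa [linearRep_character] using this
  · rintro ⟨⟨χ, n, ρ, hρ, rfl⟩, h1⟩
    obtain rfl : n = 1 := by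
      change ρ.character 1 = 1 at h1
      rw [Representation.char_one] at h1
      simpa using h1
    have hscal : ∀ g, ρ g = ρ.character g • LinearMap.id := fun g => by
      have h : LinearMap.trace ℂ (Fin 1 → ℂ) (ρ g) = (LinearMap.toMatrix' (ρ g)) 0 0 := by
        rw [LinearMap.trace_eq_matrix_trace ℂ (Pi.basisFun ℂ (Fin 1))]
        simp [Matrix.trace, LinearMap.toMatrix_eq_toMatrix']
      rw [Representation.character, h]
      refine LinearMap.toMatrix'.injective ?_
      ext i j
      fin_cases i
      fin_cases j
      simp
    let χ : G →* ℂ :=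
      { toFun := ρ.character
        map_one' := h1
        map_mul' := fun g h => by
          have : (ρ.character (g * h)) = LinearMap.trace ℂ (Fin 1 → ℂ) (ρ g * ρ h) := by
            rw [← map_mul]; rfl
          rw [this, hscal g, hscal h]
          simp [Module.End.mul_eq_comp, LinearMap.trace_id, mul_comm] }
    refine ⟨χ.toHomUnits, ?_⟩
    refine Subtype.ext (Subtype.ext (funext fun g => ?_))
    exact linearRep_character _ g

end LinearCharacters

/-! ### Fixed points of the coadjoint action -/

section FixedPoints

variable {F J : Type*} [Field F] [NonUnitalRing J] [Module F J] [IsScalarTower F J J]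
  [SMulCommClass F J J]

theorem algebraGroup_val (g : AlgebraGroup F J) :
    g.1.val = 1 + (g.1.val.snd : Unitization F J) := by
  ext
  · simp
  · simp

/-- For `g = 1 + x` one has `g (y + y x) g⁻¹ = y + x y`, so invariance under `g` compares `φ (y x)`
with `φ (x y)`. Conversely, with `g⁻¹ = 1 + x'`, the trace property moves `x'` from the right of `g
a` to its left, turning `φ (g a g⁻¹)` into `φ (g⁻¹ g a)`. -/
theorem forall_smul_eq_iff (hJ : ∀ x : J, IsUnit (1 + x : Unitization F J)) (φ : AddChar J ℂ) :
    (∀ g : AlgebraGroup F J, g • φ = φ) ↔ ∀ x y : J, φ (x * y) = φ (y * x) := by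
  constructor
  · intro h x y
    let g : AlgebraGroup F J := ⟨(hJ x).unit, by simp⟩
    have hc : conj g (y + y * x) = y + x * y := by
      apply Unitization.inr_injective (R := F)
      have h1 : ((y + y * x : J) : Unitization F J) = y * (g : (Unitization F J)ˣ).val := by
        simp [g, mul_add]
      rw [inr_conj, h1, Subgroup.coe_inv, mul_assoc, mul_assoc, Units.mul_inv, mul_one]
      simp [g, add_mul]
    have h2 : φ (conj g (y + y * x)) = φ (y + y * x) := by
      have := congrArg (fun ψ : AddChar J ℂ => ψ (y + y * x)) (h g⁻¹)
      simpa [coadjoint_apply] using this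
    rw [hc, AddChar.map_add_eq_mul, AddChar.map_add_eq_mul] at h2
    exact mul_left_cancel₀ (φ.val_isUnit y).ne_zero h2
  · intro h g
    have key : ∀ (g : AlgebraGroup F J) (a : J), φ (conj g a) = φ a := fun g a => by
      set x := g.1.val.snd
      set x' := (g⁻¹).1.val.snd
      have hx : g.1.val = 1 + (x : Unitization F J) := algebraGroup_val g
      have hx' : (g⁻¹).1.val = 1 + (x' : Unitization F J) := algebraGroup_val g⁻¹
      have e1 : conj g a = (a + x * a) + (a + x * a) * x' := by
        apply Unitization.inr_injective (R := F)
        rw [inr_conj, hx, hx']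
        simp [mul_add, add_mul]
      have e2 : (a + x * a) + x' * (a + x * a) = a := by
        apply Unitization.inr_injective (R := F)
        have h3 : ((a + x * a + x' * (a + x * a) : J) : Unitization F J) =
            (g⁻¹).1.val * (g.1.val * a) := by
          rw [hx, hx']
          simp only [Unitization.inr_add, Unitization.inr_mul, mul_add, add_mul, one_mul]
          abel
        rw [h3, Subgroup.coe_inv, Units.inv_mul_cancel_left]
      rw [e1, AddChar.map_add_eq_mul, h, ← AddChar.map_add_eq_mul, e2]
    ext a
    rw [coadjoint_apply, key]

/-- If the fake degrees are the character degrees, the order of the abelianization is the number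
of characters of `J` that do not see commutators. -/
theorem card_abelianization_of_hasFakeDegrees [Finite (AlgebraGroup F J)]
    (hJ : ∀ x : J, IsUnit (1 + x : Unitization F J)) (h : HasFakeDegrees F J) :
    Nat.card (Abelianization (AlgebraGroup F J)) =
      Nat.card {φ : AddChar J ℂ // ∀ x y : J, φ (x * y) = φ (y * x)} := by
  obtain ⟨e, he⟩ := h
  rw [← card_linear_irrChar]
  -- The bijection restricts to one between the singleton orbits and the linear characters.
  have h1 : ∀ Ω : CoadjointOrbit F J, Nat.card Ω.1 = 1 ↔ (e Ω).1 1 = 1 := fun Ω => by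
    rw [he, Complex.ofReal_eq_one, Real.sqrt_eq_one, Nat.cast_eq_one]
  rw [← Nat.card_congr (e.subtypeEquiv h1)]
  refine (Nat.card_congr (Equiv.ofBijective
    (fun φ : {φ : AddChar J ℂ // ∀ x y : J, φ (x * y) = φ (y * x)} =>
      (⟨⟨MulAction.orbit (AlgebraGroup F J) φ.1, φ.1, rfl⟩, ?_⟩ :
        {Ω : CoadjointOrbit F J // Nat.card Ω.1 = 1})) ⟨?_, ?_⟩)).symm
  · have hfix := (forall_smul_eq_iff hJ φ.1).2 φ.2
    have : MulAction.orbit (AlgebraGroup F J) φ.1 = {φ.1} := by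
      ext ψ
      simp [MulAction.mem_orbit_iff, hfix, eq_comm]
    simp [this]
  · intro φ ψ hφψ
    have horb : MulAction.orbit (AlgebraGroup F J) φ.1 = MulAction.orbit (AlgebraGroup F J) ψ.1 :=
      congrArg (fun Ω => Ω.1.1) hφψ
    have hmem : φ.1 ∈ MulAction.orbit (AlgebraGroup F J) ψ.1 :=
      horb ▸ MulAction.mem_orbit_self φ.1
    obtain ⟨g, hg⟩ := hmem
    exact Subtype.ext (hg.symm.trans ((forall_smul_eq_iff hJ ψ.1).2 ψ.2 g))
  · rintro ⟨⟨_, φ, rfl⟩, hcard⟩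
    have hsub := (Nat.card_eq_one_iff_unique.1 hcard).1
    refine ⟨⟨φ, (forall_smul_eq_iff hJ φ).1 fun g => ?_⟩, rfl⟩
    exact congrArg Subtype.val (hsub.elim ⟨g • φ, MulAction.mem_orbit φ g⟩
      ⟨φ, MulAction.mem_orbit_self φ⟩)

end FixedPoints

/-! ### Characters of the group algebra that vanish on commutators -/

section TraceCharacters

variable (F G : Type*) [Field F] [Group G]

variable {F G} in
-- By additivity the trace property need only be tested on multiples of group elements, and `g * h`
-- and `h * g` range over all conjugate pairs.
theorem traceChar_iff (φ : AddChar (MonoidAlgebra F G) ℂ) :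
    (∀ x y, φ (x * y) = φ (y * x)) ↔
      ∀ (g h : G), IsConj g h → ∀ r : F,
        φ (MonoidAlgebra.single g r) = φ (MonoidAlgebra.single h r) := by
  constructor
  · intro H g h hgh r
    obtain ⟨c, rfl⟩ := isConj_iff.1 hgh
    have := H (MonoidAlgebra.single (c * g) r) (MonoidAlgebra.single c⁻¹ 1)
    simp only [MonoidAlgebra.single_mul_single, mul_one, one_mul, inv_mul_cancel_left] at this
    exact this.symm
  · intro H x y
    induction x using MonoidAlgebra.induction_linear with
    | zero => simp
    | add a b ha hb =>
      rw [add_mul, mul_add, AddChar.map_add_eq_mul, AddChar.map_add_eq_mul, ha, hb]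
    | single g r =>
      induction y using MonoidAlgebra.induction_linear with
      | zero => simp
      | add a b ha hb =>
        rw [add_mul, mul_add, AddChar.map_add_eq_mul, AddChar.map_add_eq_mul, ha, hb]
      | single h s =>
        rw [MonoidAlgebra.single_mul_single, MonoidAlgebra.single_mul_single, mul_comm s r]
        exact H _ _ (isConj_iff.2 ⟨g⁻¹, by group⟩) _

theorem addChar_ext_single {F G : Type*} [Field F] {φ ψ : AddChar (MonoidAlgebra F G) ℂ}
    (h : ∀ g r, φ (MonoidAlgebra.single g r) = ψ (MonoidAlgebra.single g r)) : φ = ψ := by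
  ext x
  induction x using MonoidAlgebra.induction_linear with
  | zero => simp
  | add a b ha hb => rw [AddChar.map_add_eq_mul, AddChar.map_add_eq_mul, ha, hb]
  | single g r => exact h g r

/-- The additive character of the group algebra with given values on the class sums. -/
def classAddChar {F G : Type*} [Field F] [Group G] [Fintype G]
    (f : ConjClasses G → AddChar F ℂ) : AddChar (MonoidAlgebra F G) ℂ where
  toFun x := ∏ g : G, f (ConjClasses.mk g) (x.coeff g)
  map_zero_eq_one' := by simp
  map_add_eq_mul' x y := by simp [AddChar.map_add_eq_mul, Finset.prod_mul_distrib]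

variable {F G} in
theorem classAddChar_single [Fintype G] (f : ConjClasses G → AddChar F ℂ) (g : G) (r : F) :
    classAddChar f (MonoidAlgebra.single g r) = f (ConjClasses.mk g) r := by
  classical
  change ∏ h : G, f (ConjClasses.mk h) ((MonoidAlgebra.single g r).coeff h) = _
  rw [Finset.prod_eq_single g]
  · simp
  · intro h _ hne
    simp [hne.symm]
  · simp

/-- The characters of the group algebra vanishing on commutators are the functions on conjugacy
classes with values in the characters of the field. -/
theorem card_traceChar [Finite G] :
    Nat.card {φ : AddChar (MonoidAlgebra F G) ℂ // ∀ x y, φ (x * y) = φ (y * x)} =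
      Nat.card (ConjClasses G → AddChar F ℂ) := by
  have := Fintype.ofFinite G
  refine (Nat.card_congr (Equiv.ofBijective (fun f : ConjClasses G → AddChar F ℂ =>
    (⟨classAddChar f, (traceChar_iff _).2 fun g h hgh r => by
      rw [classAddChar_single, classAddChar_single, ConjClasses.mk_eq_mk_iff_isConj.2 hgh]⟩ :
      {φ : AddChar (MonoidAlgebra F G) ℂ // ∀ x y, φ (x * y) = φ (y * x)})) ⟨?_, ?_⟩)).symm
  · intro f f' h
    funext c
    obtain ⟨g, rfl⟩ := ConjClasses.exists_rep c
    ext r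
    have h1 : classAddChar f = classAddChar f' := congrArg Subtype.val h
    rw [← classAddChar_single f, h1]
    exact classAddChar_single f' g r
  · rintro ⟨φ, hφ⟩
    rw [traceChar_iff] at hφ
    let f : ConjClasses G → AddChar F ℂ := fun c =>
      { toFun := fun r => φ (MonoidAlgebra.single c.exists_rep.choose r)
        map_zero_eq_one' := by simp
        map_add_eq_mul' := fun r s => by rw [MonoidAlgebra.single_add, AddChar.map_add_eq_mul] }
    refine ⟨f, Subtype.ext (addChar_ext_single fun g r => ?_)⟩
    rw [classAddChar_single]
    exact hφ _ _ (ConjClasses.mk_eq_mk_iff_isConj.1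
      (ConjClasses.exists_rep (ConjClasses.mk g)).choose_spec) r

/-- The projection of the group algebra onto the augmentation ideal. -/
def augmentationProj : MonoidAlgebra F G →+ augmentationIdeal F G where
  toFun x := ⟨x - algebraMap F _ (augmentation F G x), by
    rw [mem_augmentationIdeal, map_sub, AlgHom.commutes]; simp⟩
  map_zero' := by ext1; simp
  map_add' x y := by
    ext1
    simp only [map_add, NonUnitalSubalgebra.coe_add]
    abel

variable {F G} in
theorem coe_augmentationProj (x : MonoidAlgebra F G) :
    (augmentationProj F G x : MonoidAlgebra F G) = x - algebraMap F _ (augmentation F G x) := rfl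

/-- The group algebra is the direct sum of the augmentation ideal and the central line `F · 1`, and
the scalar parts do not affect commutators; so a trace character is an independent pair. -/
theorem card_traceChar_augmentationIdeal :
    Nat.card {φ : AddChar (augmentationIdeal F G) ℂ // ∀ x y, φ (x * y) = φ (y * x)} *
      Nat.card (AddChar F ℂ) =
    Nat.card {φ : AddChar (MonoidAlgebra F G) ℂ // ∀ x y, φ (x * y) = φ (y * x)} := by
  rw [← Nat.card_prod]
  refine Nat.card_congr (Equiv.ofBijective (fun q :
    {φ : AddChar (augmentationIdeal F G) ℂ // ∀ x y, φ (x * y) = φ (y * x)} × AddChar F ℂ =>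
    (⟨q.1.1.compAddMonoidHom (augmentationProj F G) *
      q.2.compAddMonoidHom (augmentation F G : MonoidAlgebra F G →+ F), fun x y => ?_⟩ :
      {φ : AddChar (MonoidAlgebra F G) ℂ // ∀ x y, φ (x * y) = φ (y * x)})) ⟨?_, ?_⟩)
  · obtain ⟨⟨φ, hφ⟩, ψ⟩ := q
    -- This is the equality of the commutators of `x, y` and of their projections, rearranged to
    -- avoid subtraction.
    have h1 : augmentationProj F G (x * y) + augmentationProj F G y * augmentationProj F G x =
        augmentationProj F G (y * x) + augmentationProj F G x * augmentationProj F G y := by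
      ext1
      simp only [NonUnitalSubalgebra.coe_add, NonUnitalSubalgebra.coe_mul, coe_augmentationProj,
        map_mul, sub_mul, mul_sub]
      rw [Algebra.commutes (augmentation F G x) y, Algebra.commutes (augmentation F G y) x,
        Algebra.commutes (augmentation F G x) (algebraMap F _ (augmentation F G y))]
      abel
    have h2 := congrArg φ h1
    rw [AddChar.map_add_eq_mul, AddChar.map_add_eq_mul, hφ (augmentationProj F G y)] at h2
    have h3 := mul_right_cancel₀ (φ.val_isUnit _).ne_zero h2
    simp [h3, mul_comm (augmentation F G x)]
  · rintro ⟨⟨φ, hφ⟩, ψ⟩ ⟨⟨φ', hφ'⟩, ψ'⟩ h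
    have h1 : ∀ x, φ (augmentationProj F G x) * ψ (augmentation F G x) =
        φ' (augmentationProj F G x) * ψ' (augmentation F G x) := fun x =>
      congrArg (fun χ : {φ : AddChar (MonoidAlgebra F G) ℂ // ∀ x y, φ (x * y) = φ (y * x)} =>
        χ.1 x) h
    have e1 : φ = φ' := by
      ext x
      have hx := h1 x
      have hx0 : augmentation F G x = 0 := x.2
      have hpx : augmentationProj F G x = x := by ext1; simp [coe_augmentationProj, hx0]
      simpa [hx0, hpx] using hx
    have e2 : ψ = ψ' := by
      ext r
      have hr := h1 (algebraMap F _ r)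
      have hr0 : augmentationProj F G (algebraMap F _ r) = 0 := by
        ext1; simp [coe_augmentationProj]
      rw [hr0, AlgHom.commutes] at hr
      simpa using hr
    subst e1 e2
    rfl
  · rintro ⟨φ, hφ⟩
    refine ⟨⟨⟨φ.compAddMonoidHom (NonUnitalSubalgebraClass.subtype (augmentationIdeal F G)),
      fun x y => hφ x y⟩, φ.compAddMonoidHom (algebraMap F (MonoidAlgebra F G))⟩, ?_⟩
    ext x
    change φ (x - algebraMap F _ (augmentation F G x)) *
      φ (algebraMap F _ (augmentation F G x)) = φ x
    rw [← AddChar.map_add_eq_mul, sub_add_cancel]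

end TraceCharacters

/-! ### The predicted order of the abelianization -/

section AugmentationIdeal

variable {p : ℕ} [hp : Fact p.Prime] {G : Type*} [Group G] [Finite G]

theorem card_traceChar_augmentationIdeal_zmod :
    Nat.card {φ : AddChar (augmentationIdeal (ZMod p) G) ℂ // ∀ x y, φ (x * y) = φ (y * x)} =
      p ^ (classNumber G - 1) := by
  have hF : Nat.card (AddChar (ZMod p) ℂ) = p := by
    rw [Nat.card_eq_fintype_card, AddChar.card_eq, ZMod.card]
  have hc : classNumber G ≠ 0 := Nat.card_pos.ne'
  have h := card_traceChar_augmentationIdeal (ZMod p) G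
  rw [card_traceChar, Nat.card_fun, hF] at h
  refine Nat.eq_of_mul_eq_mul_right hp.out.pos ?_
  rw [h, ← pow_succ, Nat.sub_add_cancel (Nat.pos_of_ne_zero hc), classNumber]

instance finite_normalizedUnits : Finite (NormalizedUnits (ZMod p) G) :=
  Finite.of_equiv _ (normalizedUnitsEquiv (ZMod p) G).symm.toEquiv

/-- The order of the abelianization of `1 + I` predicted by the fake degrees. -/
theorem card_abelianization_normalizedUnits (hG : IsPGroup p G)
    (h : HasFakeDegrees (ZMod p) (augmentationIdeal (ZMod p) G)) :
    Nat.card (Abelianization (NormalizedUnits (ZMod p) G)) = p ^ (classNumber G - 1) := by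
  rw [← card_traceChar_augmentationIdeal_zmod]
  refine card_abelianization_of_hasFakeDegrees (fun x => ?_) h
  have hu : IsUnit (unitizationEquiv (ZMod p) G (1 + x)) :=
    isUnit_of_augmentation_eq_one hG ((augmentation_unitizationHom _).trans (by simp))
  exact (MulEquiv.isUnit_map (unitizationEquiv (ZMod p) G)).1 hu

end AugmentationIdeal

/-! ### The filtration by powers of `z - 1` -/

section Layers

variable {p : ℕ} [hp : Fact p.Prime] {G : Type*} [Group G]

/-- The element `z - 1` of the group algebra. -/
def subOne (p : ℕ) {G : Type*} [Group G] (z : G) : MonoidAlgebra (ZMod p) G :=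
  MonoidAlgebra.of (ZMod p) G z - 1

theorem augmentation_subOne (z : G) : augmentation (ZMod p) G (subOne p z) = 0 := by
  simp [subOne, augmentation]

theorem commute_subOne {z : G} (hz : z ∈ Subgroup.center G) (a : MonoidAlgebra (ZMod p) G) :
    Commute (subOne p z) a := by
  refine Commute.sub_left ?_ (Commute.one_left a)
  induction a using MonoidAlgebra.induction_linear with
  | zero => exact Commute.zero_right _
  | add x y hx hy => exact hx.add_right hy
  | single g r =>
    rw [Commute, SemiconjBy, MonoidAlgebra.of_apply, MonoidAlgebra.single_mul_single,
      MonoidAlgebra.single_mul_single, one_mul, mul_one, Subgroup.mem_center_iff.1 hz g]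

theorem subOne_pow {z : G} (hzp : z ^ p = 1) : subOne p z ^ p = 0 := by
  have : CharP (MonoidAlgebra (ZMod p) G) p :=
    charP_of_injective_algebraMap (algebraMap (ZMod p) (MonoidAlgebra (ZMod p) G)).injective p
  rw [subOne, sub_pow_char_of_commute _ (Commute.one_right _), ← map_pow, hzp, map_one, one_pow,
    sub_self]

theorem subOne_dvd_single_sub {z : G} (hz : z ∈ Subgroup.center G) (g : G) (r : ZMod p) (n : ℕ) :
    subOne p z ∣ MonoidAlgebra.single (g * z ^ n) r - MonoidAlgebra.single g r := by
  induction n with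
  | zero => simp
  | succ n ih =>
    have h : MonoidAlgebra.single (g * z ^ (n + 1)) r - MonoidAlgebra.single g r =
        subOne p z * MonoidAlgebra.single (g * z ^ n) r +
          (MonoidAlgebra.single (g * z ^ n) r - MonoidAlgebra.single g r) := by
      rw [subOne, sub_mul, one_mul, MonoidAlgebra.of_apply, MonoidAlgebra.single_mul_single,
        one_mul, ← Subgroup.mem_center_iff.1 hz, mul_assoc, ← pow_succ]
      abel
    rw [h]
    exact dvd_add (dvd_mul_right _ _) ih

/-- The units congruent to one modulo `(z - 1) ^ i`. -/
def congruenceUnits (p : ℕ) [Fact p.Prime] (z : G) (i : ℕ) : Subgroup (unitsOne (ZMod p) G) where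
  carrier := {u | subOne p z ^ i ∣ u.1.val - 1}
  one_mem' := by simp
  mul_mem' {u v} hu hv := by
    have h : (u * v).1.val - 1 = (u.1.val - 1) * v.1.val + (v.1.val - 1) := by
      simp [sub_mul]
    rw [Set.mem_ofPred_eq, h]
    exact dvd_add (dvd_mul_of_dvd_left hu _) hv
  inv_mem' {u} hu := by
    have h : (u⁻¹).1.val - 1 = -((u.1.val - 1) * (u⁻¹).1.val) := by
      simp [sub_mul]
    rw [Set.mem_ofPred_eq, h, dvd_neg]
    exact dvd_mul_of_dvd_left hu _

theorem mem_congruenceUnits {z : G} {i : ℕ} {u : unitsOne (ZMod p) G} :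
    u ∈ congruenceUnits p z i ↔ subOne p z ^ i ∣ u.1.val - 1 := Iff.rfl

/-- The image of the congruence units in the abelianization. -/
def layer (p : ℕ) [Fact p.Prime] (z : G) (i : ℕ) :
    Subgroup (Abelianization (unitsOne (ZMod p) G)) :=
  (congruenceUnits p z i).map Abelianization.of

/-- The class of a unit modulo a layer. -/
def layerMk (z : G) (i : ℕ) :
    unitsOne (ZMod p) G →* Abelianization (unitsOne (ZMod p) G) ⧸ layer p z i :=
  (QuotientGroup.mk' _).comp Abelianization.of

theorem layerMk_eq_one {z : G} {i : ℕ} {u : unitsOne (ZMod p) G}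
    (hu : subOne p z ^ i ∣ u.1.val - 1) : layerMk z i u = 1 :=
  (QuotientGroup.eq_one_iff _).2 ⟨u, hu, rfl⟩

theorem layerMk_eq {z : G} {i : ℕ} {u v : unitsOne (ZMod p) G}
    (h : subOne p z ^ i ∣ u.1.val - v.1.val) : layerMk z i u = layerMk z i v := by
  rw [← mul_inv_eq_one, ← map_inv, ← map_mul]
  refine layerMk_eq_one ?_
  have : (u * v⁻¹).1.val - 1 = (u.1.val - v.1.val) * (v⁻¹).1.val := by simp [sub_mul]
  rw [this]
  exact dvd_mul_of_dvd_left h _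

theorem layer_eq_bot {z : G} (hzp : z ^ p = 1) : layer p z p = ⊥ := by
  rw [layer, Subgroup.map_eq_bot_iff]
  intro u hu
  rw [mem_congruenceUnits, subOne_pow hzp, zero_dvd_iff, sub_eq_zero] at hu
  obtain rfl : u = 1 := Subtype.ext (Units.ext hu)
  exact one_mem _

theorem augmentation_subOne_pow_mul (z : G) (i : ℕ) (a : MonoidAlgebra (ZMod p) G) :
    augmentation (ZMod p) G (subOne p z ^ (i + 1) * a) = 0 := by
  rw [map_mul, map_pow, augmentation_subOne, zero_pow (Nat.succ_ne_zero i), zero_mul]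

/-- A group element as a unit of augmentation one. -/
def groupUnit (p : ℕ) [Fact p.Prime] {G : Type*} [Group G] : G →* unitsOne (ZMod p) G :=
  ((Units.map (MonoidAlgebra.of (ZMod p) G)).comp toUnits.toMonoidHom).codRestrict _ fun g =>
    mem_unitsOne.2 (by simp [augmentation])

theorem groupUnit_val (g : G) : (groupUnit p g).1.val = MonoidAlgebra.of (ZMod p) G g := rfl

/-- A homomorphism on the group algebra that takes on group elements only the values at given
representatives has a small range. -/
theorem card_range_le {C : Type*} [AddCommGroup C] (H : MonoidAlgebra (ZMod p) G →+ C)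
    {ι : Type*} [Fintype ι] (r : ι → G)
    (hr : ∀ g, H (MonoidAlgebra.single g 1) = 0 ∨
      ∃ i, H (MonoidAlgebra.single g 1) = H (MonoidAlgebra.single (r i) 1)) :
    Nat.card H.range ≤ p ^ Fintype.card ι := by
  classical
  let W : (ι → ZMod p) →+ C := AddMonoidHom.mk'
    (fun w => H (∑ i, MonoidAlgebra.single (r i) (w i))) fun w w' => by
      rw [← map_add, ← Finset.sum_add_distrib]
      simp only [Pi.add_apply, MonoidAlgebra.single_add]
  have hW : ∀ i, W (Pi.single i 1) = H (MonoidAlgebra.single (r i) 1) := fun i => by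
    change H (∑ j, MonoidAlgebra.single (r j) ((Pi.single i 1 : ι → ZMod p) j)) = _
    rw [Finset.sum_eq_single i]
    · simp
    · intro j _ hj
      simp [hj]
    · simp
  have hle : H.range ≤ W.range := by
    rintro _ ⟨a, rfl⟩
    induction a using MonoidAlgebra.induction_linear with
    | zero => rw [map_zero]; exact zero_mem _
    | add x y hx hy => rw [map_add]; exact add_mem hx hy
    | single g c =>
      -- `H` is only additive; over the prime field every scalar is a natural multiple of 1.
      have h : MonoidAlgebra.single g c = c.val • MonoidAlgebra.single g (1 : ZMod p) := by
        rw [← Nat.cast_smul_eq_nsmul (ZMod p), ZMod.natCast_zmod_val, MonoidAlgebra.smul_single,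
          smul_eq_mul, mul_one]
      rw [h, map_nsmul]
      refine nsmul_mem ?_ _
      obtain h0 | ⟨i, hi⟩ := hr g
      · rw [h0]; exact zero_mem _
      · exact ⟨Pi.single i 1, (hW i).trans hi.symm⟩
  have hfin : Finite W.range := Finite.of_surjective W.rangeRestrict W.rangeRestrict_surjective
  calc Nat.card H.range ≤ Nat.card W.range :=
        Nat.card_le_card_of_injective _ (AddSubgroup.inclusion_injective hle)
    _ ≤ Nat.card (ι → ZMod p) :=
        Nat.card_le_card_of_surjective W.rangeRestrict W.rangeRestrict_surjective
    _ = p ^ Fintype.card ι := by simp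

theorem layer_succ_le (z : G) (i : ℕ) : layer p z (i + 1) ≤ layer p z i := by
  refine Subgroup.map_mono fun u hu => ?_
  exact (pow_dvd_pow _ (Nat.le_succ i)).trans hu

variable [Finite G]

/-- The unit `1 + x` for `x` in the augmentation ideal. -/
def oneAddUnit (hG : IsPGroup p G) (x : MonoidAlgebra (ZMod p) G)
    (hx : augmentation (ZMod p) G x = 0) : unitsOne (ZMod p) G :=
  ⟨(isUnit_of_augmentation_eq_one hG (a := 1 + x) (by rw [map_add, map_one, hx, add_zero])).unit,
    mem_unitsOne.2 (by rw [IsUnit.unit_spec, map_add, map_one, hx, add_zero])⟩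

theorem oneAddUnit_val (hG : IsPGroup p G) (x : MonoidAlgebra (ZMod p) G)
    (hx : augmentation (ZMod p) G x = 0) : (oneAddUnit hG x hx).1.val = 1 + x := rfl

/-- The homomorphism `a ↦ 1 + (z - 1) ^ (i + 1) a` onto the successive quotients of the layers. -/
def layerHom (hG : IsPGroup p G) {z : G} (hz : z ∈ Subgroup.center G) (i : ℕ) :
    MonoidAlgebra (ZMod p) G →+
      Additive (Abelianization (unitsOne (ZMod p) G) ⧸ layer p z (i + 2)) :=
  AddMonoidHom.mk' (fun a => Additive.ofMul (layerMk z (i + 2)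
      (oneAddUnit hG (subOne p z ^ (i + 1) * a) (augmentation_subOne_pow_mul z i a))))
    fun a b => by
      rw [← ofMul_mul, ← map_mul]
      refine congrArg Additive.ofMul (layerMk_eq ?_)
      rw [Subgroup.coe_mul, Units.val_mul, oneAddUnit_val, oneAddUnit_val, oneAddUnit_val]
      -- The error is the cross term, divisible by `(z - 1) ^ (2 * i + 2)`, and `2 * i + 2 ≥ i + 2`.
      have h : 1 + subOne p z ^ (i + 1) * (a + b) -
          (1 + subOne p z ^ (i + 1) * a) * (1 + subOne p z ^ (i + 1) * b) =
          subOne p z ^ (i + 2) * (-(subOne p z ^ i * (a * b))) := by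
        have h1 : subOne p z ^ (i + 1) * a * (subOne p z ^ (i + 1) * b) =
            subOne p z ^ (i + 2) * (subOne p z ^ i * (a * b)) := by
          rw [← mul_assoc, mul_assoc _ a, ← ((commute_subOne hz a).pow_left (i + 1)).eq,
            ← mul_assoc, ← pow_add, mul_assoc, ← mul_assoc (subOne p z ^ (i + 2)), ← pow_add]
          congr 2
          ring
        rw [mul_neg, ← h1]
        noncomm_ring
      rw [h]
      exact dvd_mul_right _ _

theorem layerHom_apply (hG : IsPGroup p G) {z : G} (hz : z ∈ Subgroup.center G) (i : ℕ)
    (a : MonoidAlgebra (ZMod p) G) :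
    layerHom hG hz i a = Additive.ofMul (layerMk z (i + 2)
      (oneAddUnit hG (subOne p z ^ (i + 1) * a) (augmentation_subOne_pow_mul z i a))) := rfl

theorem layerHom_eq_of_dvd (hG : IsPGroup p G) {z : G} (hz : z ∈ Subgroup.center G) (i : ℕ)
    {a b : MonoidAlgebra (ZMod p) G} (h : subOne p z ∣ a - b) :
    layerHom hG hz i a = layerHom hG hz i b := by
  rw [layerHom_apply, layerHom_apply]
  refine congrArg Additive.ofMul (layerMk_eq ?_)
  rw [oneAddUnit_val, oneAddUnit_val, add_sub_add_left_eq_sub, ← mul_sub, pow_succ _ (i + 1)]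
  exact mul_dvd_mul_left _ h

/-- As `z` is central, the two units are conjugate under `c`, and the target is abelian. -/
theorem layerHom_conj (hG : IsPGroup p G) {z : G} (hz : z ∈ Subgroup.center G) (i : ℕ) (c g : G) :
    layerHom hG hz i (MonoidAlgebra.single (c * g * c⁻¹) 1) =
      layerHom hG hz i (MonoidAlgebra.single g 1) := by
  rw [layerHom_apply, layerHom_apply]
  have h : oneAddUnit hG (subOne p z ^ (i + 1) * MonoidAlgebra.single (c * g * c⁻¹) 1)
      (augmentation_subOne_pow_mul z i _) = groupUnit p c *
      oneAddUnit hG (subOne p z ^ (i + 1) * MonoidAlgebra.single g 1)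
        (augmentation_subOne_pow_mul z i _) * (groupUnit p c)⁻¹ := by
    rw [eq_mul_inv_iff_mul_eq]
    refine Subtype.ext (Units.ext ?_)
    rw [Subgroup.coe_mul, Units.val_mul, Subgroup.coe_mul, Units.val_mul, oneAddUnit_val,
      oneAddUnit_val, groupUnit_val, mul_add, add_mul, mul_one, one_mul, ← mul_assoc,
      ← ((commute_subOne hz (MonoidAlgebra.of (ZMod p) G c)).pow_left (i + 1)).eq, mul_assoc,
      mul_assoc, mul_assoc, MonoidAlgebra.of_apply, MonoidAlgebra.single_mul_single,
      MonoidAlgebra.single_mul_single]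
    simp [← mul_assoc c g]
  refine congrArg Additive.ofMul ?_
  rw [h, map_mul, map_mul, map_inv, mul_comm (layerMk z (i + 2) (groupUnit p c)),
    mul_inv_cancel_right]

/-- The unit in question is `1 + (z - 1) = z`, a product of commutators. This loss of one dimension
is what makes the final inequality strict enough. -/
theorem layerHom_one (hG : IsPGroup p G) {z : G} (hz : z ∈ Subgroup.center G)
    (hzc : z ∈ commutator G) : layerHom hG hz 0 1 = 0 := by
  rw [layerHom_apply]
  have h : oneAddUnit hG (subOne p z ^ (0 + 1) * 1) (augmentation_subOne_pow_mul z 0 1) =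
      groupUnit p z := by
    refine Subtype.ext (Units.ext ?_)
    rw [oneAddUnit_val, groupUnit_val, zero_add, pow_one, mul_one, subOne, add_sub_cancel]
  rw [h]
  exact Abelianization.commutator_subset_ker ((layerMk z (0 + 2)).comp (groupUnit p)) hzc

theorem range_layerHom (hG : IsPGroup p G) {z : G} (hz : z ∈ Subgroup.center G) (i : ℕ)
    {u : unitsOne (ZMod p) G} (hu : u ∈ congruenceUnits p z (i + 1)) :
    Additive.ofMul (layerMk z (i + 2) u) ∈ (layerHom hG hz i).range := by
  obtain ⟨a, ha⟩ := hu
  refine ⟨a, congrArg Additive.ofMul (layerMk_eq ?_)⟩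
  rw [oneAddUnit_val, ← ha, add_sub_cancel, sub_self]
  exact dvd_zero _

/-- The quotient of two consecutive layers embeds in the range of `layerHom`. -/
theorem card_layer_le (hG : IsPGroup p G) {z : G} (hz : z ∈ Subgroup.center G) (i : ℕ) :
    Nat.card (layer p z (i + 1)) ≤
      Nat.card (layerHom hG hz i).range * Nat.card (layer p z (i + 2)) := by
  have h1 := Subgroup.relIndex_mul_relIndex ⊥ (layer p z (i + 2)) (layer p z (i + 1)) bot_le
    (layer_succ_le z (i + 1))
  rw [Subgroup.relIndex_bot_left, Subgroup.relIndex_bot_left, mul_comm] at h1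
  rw [← h1]
  refine Nat.mul_le_mul_right _ ?_
  have h2 := Subgroup.relIndex_ker (layer p z (i + 1)) (QuotientGroup.mk' (layer p z (i + 2)))
  rw [QuotientGroup.ker_mk'] at h2
  rw [h2]
  have hfin : Finite (layerHom hG hz i).range :=
    Finite.of_surjective _ (layerHom hG hz i).rangeRestrict_surjective
  refine Nat.card_le_card_of_injective (β := (layerHom hG hz i).range)
    (fun x => ⟨Additive.ofMul x.1, ?_⟩) fun x y h => ?_
  · obtain ⟨x, y, ⟨u, hu, rfl⟩, rfl⟩ := x
    exact range_layerHom hG hz i hu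
  · have h3 := congrArg (fun w : (layerHom hG hz i).range => w.1) h
    exact Subtype.ext (Additive.ofMul.injective h3)

end Layers

/-! ### Comparison with the quotient by `⟨z⟩` -/

section Quotient

variable {p : ℕ} [hp : Fact p.Prime] {G Q : Type*} [Group G] [Group Q]

theorem augmentation_mapDomain (f : G →* Q) (a : MonoidAlgebra (ZMod p) G) :
    augmentation (ZMod p) Q (MonoidAlgebra.mapDomainRingHom (ZMod p) f a) =
      augmentation (ZMod p) G a := by
  induction a using MonoidAlgebra.induction_linear with
  | zero => simp
  | add x y hx hy => rw [map_add, map_add, hx, hy, map_add]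
  | single g r => simp

/-- The homomorphism between groups of units of augmentation one induced by a homomorphism. -/
def unitsOneMap (p : ℕ) [Fact p.Prime] (f : G →* Q) :
    unitsOne (ZMod p) G →* unitsOne (ZMod p) Q :=
  ((Units.map (MonoidAlgebra.mapDomainRingHom (ZMod p) f).toMonoidHom).comp
    (unitsOne (ZMod p) G).subtype).codRestrict _ fun u =>
      mem_unitsOne.2 ((augmentation_mapDomain f _).trans (mem_unitsOne.1 u.2))

theorem unitsOneMap_val (f : G →* Q) (u : unitsOne (ZMod p) G) :
    (unitsOneMap p f u).1.val = MonoidAlgebra.mapDomainRingHom (ZMod p) f u.1.val := rfl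

theorem mapDomain_section (f : G →* Q) {s : Q → G} (hs : ∀ q, f (s q) = q)
    (a : MonoidAlgebra (ZMod p) Q) :
    MonoidAlgebra.mapDomainRingHom (ZMod p) f (MonoidAlgebra.mapDomain s a) = a := by
  induction a using MonoidAlgebra.induction_linear with
  | zero => simp
  | add x y hx hy => rw [MonoidAlgebra.mapDomain_add, map_add, hx, hy]
  | single g r => simp [hs]

/-- Any lift of a unit still has augmentation one, hence is itself a unit. -/
theorem unitsOneMap_surjective [Finite G] (hG : IsPGroup p G) {f : G →* Q}
    (hf : Function.Surjective f) : Function.Surjective (unitsOneMap p f) := by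
  intro u
  have hs := mapDomain_section f (Function.rightInverse_surjInv hf) u.1.val
  set a := MonoidAlgebra.mapDomain (Function.surjInv hf) u.1.val
  have ha : augmentation (ZMod p) G a = 1 := by
    rw [← augmentation_mapDomain f, hs]
    exact mem_unitsOne.1 u.2
  exact ⟨⟨(isUnit_of_augmentation_eq_one hG ha).unit, mem_unitsOne.2 ha⟩,
    Subtype.ext (Units.ext hs)⟩

/-- Modulo `z - 1` every group element equals the chosen representative of its coset, so an element
equals the lift of its image. -/
theorem subOne_dvd_of_mapDomain_eq_zero [Finite G] {z : G} (hz : z ∈ Subgroup.center G)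
    {f : G →* Q} (hf : Function.Surjective f) (hker : f.ker = Subgroup.zpowers z)
    {a : MonoidAlgebra (ZMod p) G} (ha : MonoidAlgebra.mapDomainRingHom (ZMod p) f a = 0) :
    subOne p z ∣ a := by
  have key : ∀ a : MonoidAlgebra (ZMod p) G, subOne p z ∣
      a - MonoidAlgebra.mapDomain (Function.surjInv hf)
        (MonoidAlgebra.mapDomainRingHom (ZMod p) f a) := by
    intro a
    induction a using MonoidAlgebra.induction_linear with
    | zero => simp
    | add x y hx hy =>
      rw [map_add, MonoidAlgebra.mapDomain_add, add_sub_add_comm]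
      exact dvd_add hx hy
    | single g r =>
      have hg : (Function.surjInv hf (f g))⁻¹ * g ∈ f.ker := by
        rw [MonoidHom.mem_ker, map_mul, map_inv, Function.surjInv_eq hf, inv_mul_cancel]
      rw [hker, ← mem_powers_iff_mem_zpowers] at hg
      obtain ⟨n, hn⟩ := hg
      have hn' : g = Function.surjInv hf (f g) * z ^ n := by
        rw [eq_comm, ← eq_inv_mul_iff_mul_eq]; exact hn
      have := subOne_dvd_single_sub (p := p) hz (Function.surjInv hf (f g)) r n
      rw [← hn'] at this
      simpa using this
  have := key a
  rwa [ha, MonoidAlgebra.mapDomain_zero, sub_zero] at this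

/-- A unit mapping to 1 is congruent to 1 modulo `z - 1`; hence the quotient by the first layer is
an image of the abelianization for `Q`. -/
theorem card_abelianization_le_mul_layer [Finite G] [Finite Q] (hG : IsPGroup p G) {z : G}
    (hz : z ∈ Subgroup.center G) {f : G →* Q} (hf : Function.Surjective f)
    (hker : f.ker = Subgroup.zpowers z) :
    Nat.card (Abelianization (unitsOne (ZMod p) G)) ≤
      Nat.card (Abelianization (unitsOne (ZMod p) Q)) * Nat.card (layer p z 1) := by
  rw [← Subgroup.index_mul_card (layer p z 1), Subgroup.index_eq_card]
  refine Nat.mul_le_mul_right _ ?_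
  have hle : (unitsOneMap p f).ker ≤ (layerMk (p := p) z 1).ker := by
    intro u hu
    rw [MonoidHom.mem_ker] at hu ⊢
    refine layerMk_eq_one ?_
    rw [pow_one]
    refine subOne_dvd_of_mapDomain_eq_zero hz hf hker ?_
    rw [map_sub, ← unitsOneMap_val, hu, map_one]
    exact sub_self _
  let ψ := (unitsOneMap p f).liftOfSurjective (unitsOneMap_surjective hG hf) ⟨layerMk z 1, hle⟩
  have hψ : ∀ u, ψ (unitsOneMap p f u) = layerMk z 1 u := fun u =>
    MonoidHom.liftOfRightInverse_comp_apply _ _ _ _ u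
  refine Nat.card_le_card_of_surjective (Abelianization.lift ψ) fun x => ?_
  obtain ⟨y, rfl⟩ := QuotientGroup.mk'_surjective _ x
  obtain ⟨u, rfl⟩ := QuotientGroup.mk_surjective y
  exact ⟨Abelianization.of (unitsOneMap p f u), (Abelianization.lift_apply_of _ _).trans (hψ u)⟩

variable [Finite G]

theorem layerHom_eq_of_isConj (hG : IsPGroup p G) {z : G} (hz : z ∈ Subgroup.center G) (i : ℕ)
    {f : G →* Q} (hf : Function.Surjective f) (hker : f.ker = Subgroup.zpowers z) {g h : G}
    (hgh : IsConj (f g) (f h)) :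
    layerHom hG hz i (MonoidAlgebra.single h 1) = layerHom hG hz i (MonoidAlgebra.single g 1) := by
  obtain ⟨c, hc⟩ := isConj_iff.1 hgh
  obtain ⟨c, rfl⟩ := hf c
  have hmem : (c * g * c⁻¹)⁻¹ * h ∈ f.ker := by
    rw [MonoidHom.mem_ker, map_mul, map_inv, map_mul, map_mul, map_inv, hc, inv_mul_cancel]
  rw [hker, ← mem_powers_iff_mem_zpowers] at hmem
  obtain ⟨n, hn⟩ := hmem
  have hn' : h = (c * g * c⁻¹) * z ^ n := by
    rw [eq_comm, ← eq_inv_mul_iff_mul_eq]; exact hn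
  rw [hn', layerHom_eq_of_dvd hG hz i (subOne_dvd_single_sub hz _ 1 n), layerHom_conj]

theorem card_range_layerHom_le [Finite Q] (hG : IsPGroup p G) {z : G}
    (hz : z ∈ Subgroup.center G) (i : ℕ) {f : G →* Q} (hf : Function.Surjective f)
    (hker : f.ker = Subgroup.zpowers z) :
    Nat.card (layerHom hG hz i).range ≤ p ^ classNumber Q := by
  have := Fintype.ofFinite (ConjClasses Q)
  rw [classNumber, Nat.card_eq_fintype_card (α := ConjClasses Q)]
  refine card_range_le _ (fun c : ConjClasses Q => Function.surjInv hf c.exists_rep.choose)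
    fun g => Or.inr ⟨ConjClasses.mk (f g), ?_⟩
  refine layerHom_eq_of_isConj hG hz i hf hker ?_
  rw [Function.surjInv_eq hf]
  exact ConjClasses.mk_eq_mk_iff_isConj.1 (ConjClasses.mk (f g)).exists_rep.choose_spec

theorem card_range_layerHom_zero_le [Finite Q] (hG : IsPGroup p G) {z : G}
    (hz : z ∈ Subgroup.center G) (hzc : z ∈ commutator G) {f : G →* Q}
    (hf : Function.Surjective f) (hker : f.ker = Subgroup.zpowers z) :
    Nat.card (layerHom hG hz 0).range ≤ p ^ (classNumber Q - 1) := by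
  classical
  have := Fintype.ofFinite (ConjClasses Q)
  have hcard : Fintype.card {c : ConjClasses Q // c ≠ ConjClasses.mk 1} = classNumber Q - 1 := by
    rw [classNumber, Nat.card_eq_fintype_card, Fintype.card_subtype_compl,
      Fintype.card_subtype_eq]
  rw [← hcard]
  refine card_range_le _ (fun c : {c : ConjClasses Q // c ≠ ConjClasses.mk 1} =>
    Function.surjInv hf c.1.exists_rep.choose) fun g => ?_
  by_cases hg : ConjClasses.mk (f g) = ConjClasses.mk 1
  · left
    rw [layerHom_eq_of_isConj hG hz 0 hf hker (g := 1), ← MonoidAlgebra.one_def,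
      layerHom_one hG hz hzc]
    rw [map_one]
    exact (ConjClasses.mk_eq_mk_iff_isConj.1 hg).symm
  · refine Or.inr ⟨⟨ConjClasses.mk (f g), hg⟩, ?_⟩
    refine layerHom_eq_of_isConj hG hz 0 hf hker ?_
    rw [Function.surjInv_eq hf]
    exact ConjClasses.mk_eq_mk_iff_isConj.1 (ConjClasses.mk (f g)).exists_rep.choose_spec

/-- There are `p - 1` steps from layer 1 to the trivial layer `p`: the first contributes at most
`k(Q) - 1` to the exponent, each of the other `p - 2` at most `k(Q)`. -/
theorem card_layer_one_le [Finite Q] (hG : IsPGroup p G) {z : G}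
    (hz : z ∈ Subgroup.center G) (hzp : z ^ p = 1) (hzc : z ∈ commutator G) {f : G →* Q}
    (hf : Function.Surjective f) (hker : f.ker = Subgroup.zpowers z) :
    Nat.card (layer p z 1) ≤ p ^ (classNumber Q - 1 + classNumber Q * (p - 2)) := by
  have key : ∀ n, n ≤ p - 2 → Nat.card (layer p z 1) ≤
      p ^ (classNumber Q - 1 + classNumber Q * n) * Nat.card (layer p z (n + 2)) := by
    intro n
    induction n with
    | zero =>
      intro _
      refine (card_layer_le hG hz 0).trans (Nat.mul_le_mul_right _ ?_)
      exact card_range_layerHom_zero_le hG hz hzc hf hker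
    | succ n ih =>
      intro hn
      refine (ih (by omega)).trans ?_
      rw [mul_add, ← add_assoc, pow_add _ _ (classNumber Q * 1), mul_one, mul_assoc]
      refine Nat.mul_le_mul_left _ ((card_layer_le hG hz (n + 1)).trans ?_)
      exact Nat.mul_le_mul_right _ (card_range_layerHom_le hG hz (n + 1) hf hker)
  have h := key (p - 2) le_rfl
  rwa [Nat.sub_add_cancel hp.out.two_le, layer_eq_bot hzp, Subgroup.card_bot, mul_one] at h

/-- If no nontrivial power of `z` is a commutator, multiplication by `z` acts freely on the
conjugacy classes. -/
theorem mul_classNumber_le {p : ℕ} {G Q : Type*} [Group G] [Group Q] [Finite G] {z : G}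
    (hz : z ∈ Subgroup.center G) {f : G →* Q}
    (hf : Function.Surjective f) (hfz : f z = 1)
    (hcomm : ∀ (g h : G) (n : ℕ), ⁅g, h⁆ = z ^ n → p ∣ n) :
    p * classNumber Q ≤ classNumber G := by
  let r : ConjClasses Q → G := fun c => Function.surjInv hf c.exists_rep.choose
  have hr : ∀ c, ConjClasses.mk (f (r c)) = c := fun c => by
    rw [Function.surjInv_eq hf]
    exact c.exists_rep.choose_spec
  have hp' : p * classNumber Q = Nat.card (Fin p × ConjClasses Q) := by
    rw [Nat.card_prod, Nat.card_fin, classNumber]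
  rw [hp']
  refine Nat.card_le_card_of_injective (fun q : Fin p × ConjClasses Q =>
    ConjClasses.mk (r q.2 * z ^ (q.1 : ℕ))) ?_
  -- If `x` conjugates `r c * z ^ i` to `r c * z ^ j`, then `⁅x, r c⁆ = z ^ (j - i)`; ordering `i ≤
  -- j` keeps the exponent natural.
  have main : ∀ (c : ConjClasses Q) (i j : Fin p), i ≤ j →
      ConjClasses.mk (r c * z ^ (i : ℕ)) = ConjClasses.mk (r c * z ^ (j : ℕ)) → i = j := by
    intro c i j hij h
    obtain ⟨x, hx⟩ := isConj_iff.1 (ConjClasses.mk_eq_mk_iff_isConj.1 h)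
    have hzi : ∀ (n : ℕ) (g : G), g * z ^ n = z ^ n * g := fun n g =>
      Subgroup.mem_center_iff.1 (pow_mem hz n) g
    have hcm : ⁅x, r c⁆ = z ^ ((j : ℕ) - i) := by
      have hsplit : z ^ (j : ℕ) = z ^ ((j : ℕ) - i) * z ^ (i : ℕ) := by
        rw [← pow_add, Nat.sub_add_cancel hij]
      have h1 : x * r c * x⁻¹ * z ^ (i : ℕ) = z ^ ((j : ℕ) - i) * r c * z ^ (i : ℕ) := by
        rw [mul_assoc, hzi i x⁻¹, ← mul_assoc, mul_assoc x, hx, hsplit, ← mul_assoc, hzi _ (r c)]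
      rw [commutatorElement_def, mul_right_cancel h1, mul_inv_cancel_right]
    have hdvd := hcomm _ _ _ hcm
    have hlt : (j : ℕ) - i < p := lt_of_le_of_lt (Nat.sub_le _ _) j.2
    have h0 := Nat.eq_zero_of_dvd_of_lt hdvd hlt
    exact le_antisymm hij (Nat.sub_eq_zero_iff_le.1 h0)
  rintro ⟨i, c⟩ ⟨j, c'⟩ h
  have hcc : c = c' := by
    have h1 : ConjClasses.mk (f (r c * z ^ (i : ℕ))) = ConjClasses.mk (f (r c' * z ^ (j : ℕ))) :=
      congrArg (ConjClasses.map f) h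
    rwa [map_mul, map_mul, map_pow, map_pow, hfz, one_pow, one_pow, mul_one, mul_one, hr,
      hr] at h1
  subst hcc
  rcases le_total i j with hij | hij
  · rw [main c i j hij h]
  · rw [main c j i hij h.symm]

theorem card_abelianization_unitsOne_mul_le [Finite Q] (hG : IsPGroup p G) {z : G}
    (hz : z ∈ Subgroup.center G) (hzp : z ^ p = 1) (hzc : z ∈ commutator G)
    (hcomm : ∀ (g h : G) (n : ℕ), ⁅g, h⁆ = z ^ n → p ∣ n) {f : G →* Q}
    (hf : Function.Surjective f) (hker : f.ker = Subgroup.zpowers z) :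
    Nat.card (Abelianization (unitsOne (ZMod p) G)) * p ^ (classNumber Q + 1) ≤
      Nat.card (Abelianization (unitsOne (ZMod p) Q)) * p ^ classNumber G := by
  have hfz : f z = 1 := MonoidHom.mem_ker.1 (hker ▸ Subgroup.mem_zpowers z)
  have hk : 0 < classNumber Q := Nat.card_pos
  have hexp : classNumber Q - 1 + classNumber Q * (p - 2) + (classNumber Q + 1) =
      p * classNumber Q := by
    obtain ⟨m, hm⟩ := Nat.exists_eq_add_of_le hp.out.two_le
    have h2 : p - 2 = m := by omega
    rw [h2]
    conv_rhs => rw [hm, add_mul, mul_comm m]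
    omega
  calc Nat.card (Abelianization (unitsOne (ZMod p) G)) * p ^ (classNumber Q + 1)
      ≤ (Nat.card (Abelianization (unitsOne (ZMod p) Q)) * Nat.card (layer p z 1)) *
          p ^ (classNumber Q + 1) :=
        Nat.mul_le_mul_right _ (card_abelianization_le_mul_layer hG hz hf hker)
    _ ≤ (Nat.card (Abelianization (unitsOne (ZMod p) Q)) *
          p ^ (classNumber Q - 1 + classNumber Q * (p - 2))) * p ^ (classNumber Q + 1) :=
        Nat.mul_le_mul_right _ (Nat.mul_le_mul_left _
          (card_layer_one_le hG hz hzp hzc hf hker))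
    _ = Nat.card (Abelianization (unitsOne (ZMod p) Q)) * p ^ (p * classNumber Q) := by
        rw [mul_assoc, ← pow_add, hexp]
    _ ≤ Nat.card (Abelianization (unitsOne (ZMod p) Q)) * p ^ classNumber G :=
        Nat.mul_le_mul_left _ (Nat.pow_le_pow_right hp.out.pos
          (mul_classNumber_le hz hf hfz hcomm))

end Quotient

/-! ### The contradiction -/

section Main

variable (p : ℕ) [hp : Fact p.Prime]

theorem isPGroup_piTilde : IsPGroup p (PiTilde p) :=
  (PiGroup.finite_and_isPGroup p).2.to_quotient _

theorem card_abelianization_normalizedUnits_mul_le :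
    Nat.card (Abelianization (NormalizedUnits (ZMod p) (PiGroup p))) *
        p ^ (classNumber (PiTilde p) + 1) ≤
      Nat.card (Abelianization (NormalizedUnits (ZMod p) (PiTilde p))) *
        p ^ classNumber (PiGroup p) := by
  rw [Nat.card_congr (normalizedUnitsEquiv (ZMod p) (PiGroup p)).abelianizationCongr.toEquiv,
    Nat.card_congr (normalizedUnitsEquiv (ZMod p) (PiTilde p)).abelianizationCongr.toEquiv]
  exact card_abelianization_unitsOne_mul_le (PiGroup.finite_and_isPGroup p).2
    (zElement_mem_center p) (zElement_pow p) (zElement_mem_commutator p)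
    (fun _ _ _ => dvd_of_commutator_eq_zElement_pow p) (QuotientGroup.mk'_surjective _)
    (by rw [QuotientGroup.ker_mk', normalClosure_zElement])

/-- The two groups cannot both satisfy the conjecture. -/
theorem not_hasFakeDegrees_or :
    ¬ HasFakeDegrees (ZMod p) (augmentationIdeal (ZMod p) (PiGroup p)) ∨
      ¬ HasFakeDegrees (ZMod p) (augmentationIdeal (ZMod p) (PiTilde p)) := by
  by_contra! h
  have hle := card_abelianization_normalizedUnits_mul_le p
  rw [card_abelianization_normalizedUnits (PiGroup.finite_and_isPGroup p).2 h.1,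
    card_abelianization_normalizedUnits (isPGroup_piTilde p) h.2, ← pow_add, ← pow_add,
    Nat.pow_le_pow_iff_right hp.out.one_lt] at hle
  -- Positivity makes the truncated subtractions honest; the exponents then sum to `k(π) + k(Q)` on
  -- the left and `k(π) + k(Q) - 1` on the right.
  have h1 : 0 < classNumber (PiGroup p) := Nat.card_pos
  have h2 : 0 < classNumber (PiTilde p) := Nat.card_pos
  omega

end Main

end FakeDegree

end

theorem mainTheorem10 (p : ℕ) [Fact p.Prime] :
    -- the Fake Degree Conjecture fails for `F_p`-algebra groups
    ¬ FakeDegree.FakeDegreeConjecture (ZMod p) ∧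
    -- the groups of normalized units of `F_p[π]` and `F_p[π/⟨z⟩]` are `F_p`-algebra groups
    (Finite (FakeDegree.augmentationIdeal (ZMod p) (FakeDegree.PiGroup p)) ∧
      FakeDegree.IsNilpotentAlgebra
        (FakeDegree.augmentationIdeal (ZMod p) (FakeDegree.PiGroup p)) ∧
      Finite (FakeDegree.augmentationIdeal (ZMod p) (FakeDegree.PiTilde p)) ∧
      FakeDegree.IsNilpotentAlgebra
        (FakeDegree.augmentationIdeal (ZMod p) (FakeDegree.PiTilde p))) ∧
    -- and at least one of them violates the conjecture
    (¬ FakeDegree.HasFakeDegrees (ZMod p)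
        (FakeDegree.augmentationIdeal (ZMod p) (FakeDegree.PiGroup p)) ∨
      ¬ FakeDegree.HasFakeDegrees (ZMod p)
        (FakeDegree.augmentationIdeal (ZMod p) (FakeDegree.PiTilde p))) ∧
    -- the orders of the abelianizations that the conjecture would force
    (FakeDegree.HasFakeDegrees (ZMod p)
        (FakeDegree.augmentationIdeal (ZMod p) (FakeDegree.PiGroup p)) →
      Nat.card (Abelianization (FakeDegree.NormalizedUnits (ZMod p) (FakeDegree.PiGroup p))) =
        p ^ (FakeDegree.classNumber (FakeDegree.PiGroup p) - 1)) ∧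
    (FakeDegree.HasFakeDegrees (ZMod p)
        (FakeDegree.augmentationIdeal (ZMod p) (FakeDegree.PiTilde p)) →
      Nat.card (Abelianization (FakeDegree.NormalizedUnits (ZMod p) (FakeDegree.PiTilde p))) =
        p ^ (FakeDegree.classNumber (FakeDegree.PiTilde p) - 1)) ∧
    -- the bound on the order of the abelianization for `π` relative to that for `π/⟨z⟩`
    Nat.card (Abelianization (FakeDegree.NormalizedUnits (ZMod p) (FakeDegree.PiGroup p))) *
        p ^ (FakeDegree.classNumber (FakeDegree.PiTilde p) + 1) ≤
      Nat.card (Abelianization (FakeDegree.NormalizedUnits (ZMod p) (FakeDegree.PiTilde p))) *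
        p ^ FakeDegree.classNumber (FakeDegree.PiGroup p) := by
  have hP := (FakeDegree.PiGroup.finite_and_isPGroup p).2
  have hT := FakeDegree.isPGroup_piTilde p
  have hnilP := FakeDegree.isNilpotentAlgebra_augmentationIdeal hP
  have hnilT := FakeDegree.isNilpotentAlgebra_augmentationIdeal hT
  have hnot := FakeDegree.not_hasFakeDegrees_or p
  refine ⟨fun h => ?_, ⟨inferInstance, hnilP, inferInstance, hnilT⟩, hnot,
    FakeDegree.card_abelianization_normalizedUnits hP,
    FakeDegree.card_abelianization_normalizedUnits hT,
    FakeDegree.card_abelianization_normalizedUnits_mul_le p⟩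
  exact hnot.elim (fun hn => hn (h _ hnilP)) (fun hn => hn (h _ hnilT))
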